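/- \textbf{Theorem (Relative monadicity).} Let $\mathbb X$ be a virtual equipment, that is, a virtual double category (with objects, a category of tight-cells $f \colon A \to B$, loose-cells $p \colon X \nrightarrow Y$, and 2-cells $p_1, \dots, p_n \Rightarrow q$, $n \ge 0$, with a tight-cell on either side) in which every object $A$ has a loose-identity $A(1,1)$ and every loose-cell $p$ has a restriction $p(f,g)$ along every pair of tight-cells; write $E(f,g)$ for the restriction $E(1,1)(f,g)$. For tight-cells $f \colon A \to B$ and $g \colon B \to C$ write $gf \colon A \to C$ for their composite. Let $j \colon A \to E$ be a dense tight-cell. Then a tight-cell $r \colon D \to E$ is strictly $j$-monadic if and only if the following three conditions hold: $r$ admits a left $j$-adjoint; the induced $j$-monad admits an algebra object; and $r$ strictly creates $j$-absolute $r$-extensions. The terms are as follows. \emph{Colimits and density.} For a loose-cell $p \colon Y \nrightarrow Z$ and a tight-cell $f \colon Z \to E$, a tight-cell $c \colon Y \to E$ with a 2-cell $\lambda \colon p \Rightarrow E(f,c)$ is the $p$-weighted colimit of $f$ if, for all $n \ge 0$ and all loose-cells $q_1, \dots, q_n$, pasting with $\lambda$ is a bijection from 2-cells $q_1, \dots,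 q_n \Rightarrow E(c,1)$ to 2-cells $p, q_1, \dots, q_n \Rightarrow E(f,1)$. The left extension $c \rhd f$ of $f \colon Z \to E$ along $c \colon Z \to C$ is the $C(c,1)$-weighted colimit of $f$. The tight-cell $j$ is dense if $1_E$, with the identity 2-cell of $E(j,1)$, is the left extension $j \rhd j$. \emph{$j$-absoluteness.} A 2-cell $s_1, \dots, s_m \Rightarrow q$ (with identity tight-cells on its sides) exhibits $q$ as the left-composite of $s_1, \dots, s_m$ if every 2-cell with source $s_1, \dots, s_m, q_1, \dots, q_n$, $n \ge 0$, factors uniquely through it. A colimit $(c, \lambda)$ as above is $j$-absolute if the left-composite of $E(j,f), p$ exists and the canonical 2-cell from it to $E(j,c)$, induced by $\lambda$, is invertible. \emph{Creation.} An $r$-extension is a left extension $c \rhd r$ along some tight-cell $c$ with domain $D$, that is, a $C(c,1)$-weighted colimit $(r', \lambda)$ of $r = r \, 1_D$. It is strictly created by $r$ if there is a unique pair of a tight-cell $d \colon C \to D$ and a 2-cell $\lambda' \colon C(c,1) \Rightarrow D(1,d)$ with $r d = r'$ and $r \lambda' = \lambda$, and this pair is the $C(c,1)$-weighted colimit of $1_D$.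 \emph{Relative adjunctions, monads and algebras.} A left $j$-adjoint of $r \colon D \to E$ is a tight-cell $\ell \colon A \to D$ with an isomorphism $D(\ell,1) \cong E(j,r)$. A $j$-monad $T$ is a tight-cell $t \colon A \to E$ with 2-cells $\dagger \colon E(j,t) \Rightarrow E(t,t)$ and $\eta \colon j \Rightarrow t$ such that: $\dagger$ followed by precomposition with $\eta$ is the identity of $E(j,t)$; $\eta$ followed by $\dagger$ is the identity of $t$; and the two 2-cells $E(j,t), E(j,t) \Rightarrow E(t,t)$, one applying $\dagger$ to both factors and composing, the other applying $\dagger$ to the second factor, composing, and applying $\dagger$ to the result, are equal. A relative adjunction induces a $j$-monad on $t = r\ell$, whose unit is the transpose of the identity of $\ell$ and whose operator is $E(j, r\ell) \cong D(\ell, \ell) \Rightarrow E(r\ell, r\ell)$. A $T$-algebra is a tight-cell $e \colon C \to E$ with a 2-cell $\rtimes \colon E(j,e) \Rightarrow E(t,e)$ such that $\rtimes$ followed by precomposition with $\eta$ is the identity of $E(j,e)$, and such that the two 2-cells $E(j,t), E(j,e) \Rightarrow E(t,e)$, one applying $\dagger$ and $\rtimes$ and composing, the other applying $\rtimes$ to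 the second factor, composing, and applying $\rtimes$ to the result, are equal. A $(p_1, \dots, p_n)$-graded morphism of $T$-algebras, $n \ge 0$, is a 2-cell $\epsilon \colon p_1, \dots, p_n \Rightarrow E(e,e')$ such that the two 2-cells $E(j,e), p_1, \dots, p_n \Rightarrow E(t,e')$, one applying $\rtimes$ and then composing with $\epsilon$, the other composing with $\epsilon$ and then applying $\rtimes'$, are equal. \emph{Algebra objects.} A $T$-algebra $(u \colon M \to E, \rtimes_u)$ is an algebra object if (i) for every $T$-algebra $(e \colon C \to E, \rtimes)$ there is a unique tight-cell $c \colon C \to M$ with $u c = e$ and $\rtimes_u(1,c) = \rtimes$; and (ii) for all algebras $e, e'$ with corresponding tight-cells $c, c'$, every graded morphism $p_1, \dots, p_n \Rightarrow E(e,e')$ is obtained by postcomposing $u$ from a unique 2-cell $p_1, \dots, p_n \Rightarrow M(c,c')$. \emph{Strict monadicity.} The tight-cell $r$ is strictly $j$-monadic if it admits a left $j$-adjoint $\ell$, the induced $j$-monad $T$ admits an algebra object $u \colon M \to E$, and the comparison tight-cell $D \to M$, namely the one that (i) assigns to the $T$-algebra $r$ with operator $E(j,r) \cong D(\ell,1)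 \Rightarrow E(r\ell, r)$, is an isomorphism. -/

import Mathlib

open CategoryTheory

set_option linter.checkUnivs false

universe t w v u

namespace Equip

/-- A chain `p₁, …, pₙ` (`n ≥ 0`) of composable loose-cells.  Throughout, `L A B` is the type of
loose-cells whose left-hand (contravariant) object is `A` and whose right-hand object is `B`, that
is, of loose-cells from `B` to `A` in the convention in which `p(f, g)` is a restriction of `p` and
`E(f, g)` is a restriction of the loose-identity of `E`; chains therefore read from left to right. -/
inductive LooseChain {X : Type u} (L : X → X → Type w) : X → X → Type (max u w)
  | nil (A : X) : LooseChain L A A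
  | cons {A B C : X} (p : L A B) (ps : LooseChain L B C) : LooseChain L A C

namespace LooseChain

variable {X : Type u} {L : X → X → Type w}

abbrev single {A B : X} (p : L A B) : LooseChain L A B := cons p (nil B)

def append : {A B C : X} → LooseChain L A B → LooseChain L B C → LooseChain L A C
  | _, _, _, nil _, qs => qs
  | _, _, _, cons p ps, qs => cons p (append ps qs)

theorem append_nil {A B : X} (ps : LooseChain L A B) : ps.append (nil B) = ps := by
  induction ps with
  | nil => rfl
  | cons p ps ih => simp only [append, ih]

theorem append_assoc {A B C D : X} (ps : LooseChain L A B) (qs : LooseChain L B C)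
    (rs : LooseChain L C D) : (ps.append qs).append rs = ps.append (qs.append rs) := by
  induction ps with
  | nil => rfl
  | cons p ps ih => simp only [append, ih]

end LooseChain

/-- The underlying graph of a virtual double category on a type `X` of objects: a category of
tight-cells, loose-cells, and 2-cells with an arbitrary chain of loose-cells as source, one
loose-cell as target, and a tight-cell on either side. -/
class DoubleGraph (X : Type u) extends Category.{v} X where
  Loose : X → X → Type w
  Cell : ∀ {A B A' B' : X}, (A ⟶ A') → LooseChain Loose A B → Loose A' B' → (B ⟶ B') → Type t

open DoubleGraph

abbrev Chain {X : Type u} [DoubleGraph.{t, w, v, u} X] (A B : X) : Type (max u w) :=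
  LooseChain (X := X) Loose A B

/-- A list of horizontally adjacent 2-cells, whose targets form the second chain and whose sources
concatenate to the first one.  The empty list on a tight-cell is allowed. -/
inductive Cells {X : Type u} [DoubleGraph.{t, w, v, u} X] :
    {A B A' B' : X} → (A ⟶ A') → Chain A B → Chain A' B' → (B ⟶ B') → Type (max u v w t)
  | nil {A A' : X} {f g : A ⟶ A'} (h : f = g) :
      Cells f (LooseChain.nil A) (LooseChain.nil A') g
  | cons {A B C A' B' C' : X} {f : A ⟶ A'} {g : B ⟶ B'} {h : C ⟶ C'}
      {ps : Chain A B} {ps' : Chain B C} {ps'' : Chain A C} {q : Loose A' B'} {qs : Chain B' C'}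
      (φ : Cell f ps q g) (Φ : Cells g ps' qs h) (e : ps.append ps' = ps'') :
      Cells f ps'' (LooseChain.cons q qs) h

namespace Cells
variable {X : Type u} [DoubleGraph.{t, w, v, u} X]

def single {A B A' B' : X} {f : A ⟶ A'} {ps : Chain A B} {q : Loose A' B'} {g : B ⟶ B'}
    (φ : Cell f ps q g) : Cells f ps (LooseChain.single q) g :=
  cons φ (nil rfl) ps.append_nil

def append : {A B C A' B' C' : X} → {f : A ⟶ A'} → {g : B ⟶ B'} → {h : C ⟶ C'} →
    {ps : Chain A B} → {qs : Chain A' B'} → {ps' : Chain B C} → {qs' : Chain B' C'} →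
    Cells f ps qs g → Cells g ps' qs' h → Cells f (ps.append ps') (qs.append qs') h
  | _, _, _, _, _, _, _, _, _, _, _, _, _, nil e, Ψ => e ▸ Ψ
  | _, _, _, _, _, _, _, _, _, _, _, _, _, cons φ Φ e, Ψ =>
      cons φ (Φ.append Ψ) (by rw [← e, LooseChain.append_assoc])

theorem append_nil {A B A' B' : X} {f : A ⟶ A'} {g : B ⟶ B'} {ps : Chain A B} {qs : Chain A' B'}
    (Φ : Cells f ps qs g) : HEq (Φ.append (nil (rfl : g = g))) Φ := by
  induction Φ with
  | nil e => subst e; rfl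
  | cons φ Φ e ih =>
    subst e
    have key : ∀ {A B C A' B' C' : X} {f : A ⟶ A'} {g : B ⟶ B'} {h : C ⟶ C'}
        {ps : Chain A B} {ps₁ ps₂ : Chain B C} {q : Loose A' B'} {qs₁ qs₂ : Chain B' C'}
        (φ : Cell f ps q g) (Φ₁ : Cells g ps₁ qs₁ h) (Φ₂ : Cells g ps₂ qs₂ h)
        {ps' : Chain A C} (e : ps.append ps₁ = ps'), ps₁ = ps₂ → qs₁ = qs₂ → HEq Φ₁ Φ₂ →
        HEq (cons φ Φ₁ e) (cons φ Φ₂ (rfl : ps.append ps₂ = _)) := by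
      intro _ _ _ _ _ _ _ _ _ _ _ _ _ _ _ _ _ _ _ e h₁ h₂ h₃
      subst h₁ h₂ e
      cases h₃
      rfl
    exact key φ _ Φ _ (LooseChain.append_nil _) (LooseChain.append_nil _) ih

end Cells

/-- Identity 2-cells, and composition of a list of 2-cells `φ₁, …, φₙ` with a 2-cell
`ψ : q₁, …, qₙ ⇒ r`.  The outer tight-cells of the composite are the composites `k = f ≫ f'` and
`l = g ≫ g'`; recording the equations avoids transports. -/
class VirtualDoubleStruct (X : Type u) extends DoubleGraph.{t, w, v, u} X where
  idCell {A B : X} (p : Loose A B) : Cell (𝟙 A) (LooseChain.single p) p (𝟙 B)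
  compCell {A B A' B' A'' B'' : X} {f : A ⟶ A'} {ps : LooseChain Loose A B}
    {qs : LooseChain Loose A' B'} {g : B ⟶ B'}
    {f' : A' ⟶ A''} {r : Loose A'' B''} {g' : B' ⟶ B''} {k : A ⟶ A''} {l : B ⟶ B''}
    (Φ : Cells f ps qs g) (ψ : Cell f' qs r g') (hk : f ≫ f' = k) (hl : g ≫ g' = l) :
    Cell k ps r l

open VirtualDoubleStruct

namespace Cells
variable {X : Type u} [VirtualDoubleStruct.{t, w, v, u} X]

def id : {A B : X} → (ps : Chain A B) → Cells (𝟙 A) ps ps (𝟙 B)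
  | _, _, LooseChain.nil _ => nil rfl
  | _, _, LooseChain.cons p ps => cons (idCell p) (id ps) rfl

/-- `IsComp Φ Ψ Ξ`: the list `Ξ` is the composite of the list `Φ` with the list `Ψ`, that is, `Φ`
is cut into consecutive blocks, one for each member of `Ψ`, and each member of `Ξ` is the composite
of the corresponding block and the corresponding member of `Ψ`. -/
inductive IsComp : {A B A' B' A'' B'' : X} → {f : A ⟶ A'} → {f' : A' ⟶ A''} → {k : A ⟶ A''} →
    {ps : Chain A B} → {qs : Chain A' B'} → {rs : Chain A'' B''} →
    {g : B ⟶ B'} → {g' : B' ⟶ B''} → {l : B ⟶ B''} →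
    Cells f ps qs g → Cells f' qs rs g' → Cells k ps rs l → Prop
  | nil {A A' A'' : X} {f g : A ⟶ A'} {f' g' : A' ⟶ A''} {k l : A ⟶ A''}
      (h : f = g) (h' : f' = g') (h'' : k = l) (hk : f ≫ f' = k) : IsComp (nil h) (nil h') (nil h'')
  | cons {A B C A' B' C' A'' B'' C'' : X} {f : A ⟶ A'} {g : B ⟶ B'} {h : C ⟶ C'}
      {f' : A' ⟶ A''} {g' : B' ⟶ B''} {h' : C' ⟶ C''} {k : A ⟶ A''} {l : B ⟶ B''} {m : C ⟶ C''}
      {ps₁ : Chain A B} {ps₂ : Chain B C} {qs₁ : Chain A' B'} {qs₂ : Chain B' C'}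
      {r : Loose A'' B''} {rs : Chain B'' C''}
      (Φ₁ : Cells f ps₁ qs₁ g) (Φ₂ : Cells g ps₂ qs₂ h)
      (ψ : Cell f' qs₁ r g') (Ψ : Cells g' qs₂ rs h') (Ξ : Cells l ps₂ rs m)
      (hk : f ≫ f' = k) (hl : g ≫ g' = l) :
      IsComp Φ₂ Ψ Ξ → IsComp (Φ₁.append Φ₂) (cons ψ Ψ rfl) (cons (compCell Φ₁ ψ hk hl) Ξ rfl)

end Cells

/-- A virtual double category. -/
class VirtualDoubleCategory (X : Type u) extends VirtualDoubleStruct.{t, w, v, u} X where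
  id_compCell {A B A' B' : X} {f : A ⟶ A'} {ps : LooseChain Loose A B} {q : Loose A' B'}
    {g : B ⟶ B'} (φ : Cell f ps q g) :
    compCell (Cells.id ps) φ (Category.id_comp f) (Category.id_comp g) = φ
  compCell_id {A B A' B' : X} {f : A ⟶ A'} {ps : LooseChain Loose A B} {q : Loose A' B'}
    {g : B ⟶ B'} (φ : Cell f ps q g) :
    compCell (Cells.single φ) (idCell q) (Category.comp_id f) (Category.comp_id g) = φ
  compCell_assoc {A B A' B' A'' B'' A₀ B₀ : X} {f : A ⟶ A'} {f' : A' ⟶ A''} {f'' : A'' ⟶ A₀}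
    {g : B ⟶ B'} {g' : B' ⟶ B''} {g'' : B'' ⟶ B₀}
    {ps : LooseChain Loose A B} {qs : LooseChain Loose A' B'} {rs : LooseChain Loose A'' B''}
    {s : Loose A₀ B₀} (Φ : Cells f ps qs g) (Ψ : Cells f' qs rs g')
    (Ξ : Cells (f ≫ f') ps rs (g ≫ g')) (χ : Cell f'' rs s g'') (h : Cells.IsComp Φ Ψ Ξ) :
    compCell Φ (compCell Ψ χ rfl rfl) rfl rfl =
      compCell Ξ χ (Category.assoc f f' f'') (Category.assoc g g' g'')

open VirtualDoubleCategory

section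
variable {X : Type u} [VirtualDoubleCategory.{t, w, v, u} X]

/-- Opcartesian 2-cells: every 2-cell whose source contains the chain `ps` factors uniquely
through `κ`. -/
def IsOpcartesian {A B : X} {ps : Chain A B} {q : Loose A B}
    (κ : Cell (𝟙 A) ps q (𝟙 B)) : Prop :=
  ∀ ⦃A₀ B₀ A' B' : X⦄ (ls : Chain A₀ A) (rs : Chain B B₀) (f : A₀ ⟶ A') (s : Loose A' B')
    (g : B₀ ⟶ B') (θ : Cell f (ls.append (ps.append rs)) s g),
    ∃! θ' : Cell f (ls.append (LooseChain.cons q rs)) s g,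
      compCell ((Cells.id ls).append (Cells.cons κ (Cells.id rs) rfl)) θ'
        (Category.id_comp f) (Category.id_comp g) = θ

/-- Left-opcartesian 2-cells: every 2-cell whose source begins with the chain `ps` factors uniquely
through `κ`.  The target `q` is then a left-composite of the chain. -/
def IsLeftOpcartesian {A B : X} {ps : Chain A B} {q : Loose A B}
    (κ : Cell (𝟙 A) ps q (𝟙 B)) : Prop :=
  ∀ ⦃B₀ A' B' : X⦄ (rs : Chain B B₀) (f : A ⟶ A') (s : Loose A' B')
    (g : B₀ ⟶ B') (θ : Cell f (ps.append rs) s g),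
    ∃! θ' : Cell f (LooseChain.cons q rs) s g,
      compCell (Cells.cons κ (Cells.id rs) rfl) θ'
        (Category.id_comp f) (Category.id_comp g) = θ

/-- Cartesian 2-cells, which exhibit their source as the restriction `p(f, g)`. -/
def IsCartesian {A B A' B' : X} {p' : Loose A B} {f : A ⟶ A'} {p : Loose A' B'} {g : B ⟶ B'}
    (ρ : Cell f (LooseChain.single p') p g) : Prop :=
  ∀ ⦃C D : X⦄ (h : C ⟶ A) (k : D ⟶ B) (qs : Chain C D) (θ : Cell (h ≫ f) qs p (k ≫ g)),
    ∃! θ' : Cell h qs p' k, compCell (Cells.single θ') ρ rfl rfl = θ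

/-- Invertible 2-cells between parallel loose-cells. -/
def IsInvertible {A B : X} {p q : Loose A B}
    (θ : Cell (𝟙 A) (LooseChain.single p) q (𝟙 B)) : Prop :=
  ∃ θ' : Cell (𝟙 A) (LooseChain.single q) p (𝟙 B),
    compCell (Cells.single θ) θ' (Category.comp_id _) (Category.comp_id _) = idCell p ∧
    compCell (Cells.single θ') θ (Category.comp_id _) (Category.comp_id _) = idCell q

end

/-- A virtual equipment: a virtual double category with a (chosen) loose-identity on each object
and (chosen) restrictions of each loose-cell along each pair of tight-cells. -/
class VirtualEquipment (X : Type u) extends VirtualDoubleCategory.{t, w, v, u} X where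
  unit (A : X) : Loose A A
  unitCell (A : X) : Cell (𝟙 A) (LooseChain.nil A) (unit A) (𝟙 A)
  unitCell_opcartesian (A : X) : IsOpcartesian (X := X) (unitCell A)
  restr {A B A' B' : X} (f : A ⟶ A') (p : Loose A' B') (g : B ⟶ B') : Loose A B
  restrCell {A B A' B' : X} (f : A ⟶ A') (p : Loose A' B') (g : B ⟶ B') :
    Cell f (LooseChain.single (restr f p g)) p g
  restrCell_cartesian {A B A' B' : X} (f : A ⟶ A') (p : Loose A' B') (g : B ⟶ B') :
    IsCartesian (X := X) (restrCell f p g)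

open VirtualEquipment

section Lemmas
variable {X : Type u} [VirtualDoubleCategory.{t, w, v, u} X]

theorem isComp_cons_nil {A B A' B' A'' B'' : X} {f : A ⟶ A'} {ps : Chain A B}
    {qs : Chain A' B'} {g : B ⟶ B'} {f' : A' ⟶ A''} {r : Loose A'' B''} {g' : B' ⟶ B''}
    {k : A ⟶ A''} {l : B ⟶ B''}
    (Φ : Cells f ps qs g) (ψ : Cell f' qs r g') (hk : f ≫ f' = k) (hl : g ≫ g' = l)
    (h₁ : qs.append (.nil _) = qs) (h₂ : ps.append (.nil _) = ps) (h₃ : g' = g') (h₄ : l = l) :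
    Cells.IsComp Φ (Cells.cons ψ (Cells.nil h₃) h₁)
      (Cells.cons (compCell Φ ψ hk hl) (Cells.nil h₄) h₂) := by
  have key : ∀ {qs' : Chain A' B'} {ps' : Chain A B} (h₁ : qs.append (.nil _) = qs')
      (h₂ : ps.append (.nil _) = ps') (Φ' : Cells f ps' qs' g),
      HEq (Φ.append (Cells.nil (rfl : g = g))) Φ' →
      Cells.IsComp Φ' (Cells.cons ψ (Cells.nil h₃) h₁)
      (Cells.cons (compCell Φ ψ hk hl) (Cells.nil h₄) h₂) := by
    intro qs' ps' h₁ h₂ Φ' h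
    subst h₁ h₂
    cases h
    exact .cons _ _ _ _ _ _ _ (.nil _ _ _ hl)
  exact key _ _ _ Φ.append_nil

theorem comp_assoc' {A B A' B' A'' B'' A₀ B₀ : X} {f : A ⟶ A'} {f' : A' ⟶ A''} {f'' : A'' ⟶ A₀}
    {g : B ⟶ B'} {g' : B' ⟶ B''} {g'' : B'' ⟶ B₀}
    {ps : Chain A B} {qs : Chain A' B'} {rs : Chain A'' B''}
    {k : A ⟶ A''} {l : B ⟶ B''} {m : A' ⟶ A₀} {n : B' ⟶ B₀} {x : A ⟶ A₀} {y : B ⟶ B₀}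
    {s : Loose A₀ B₀} (Φ : Cells f ps qs g) (Ψ : Cells f' qs rs g')
    (Ξ : Cells k ps rs l) (χ : Cell f'' rs s g'') (h : Cells.IsComp Φ Ψ Ξ)
    (hk : f ≫ f' = k) (hl : g ≫ g' = l)
    (h₁ : f' ≫ f'' = m) (h₂ : g' ≫ g'' = n) (h₃ : f ≫ m = x) (h₄ : g ≫ n = y)
    (h₅ : k ≫ f'' = x) (h₆ : l ≫ g'' = y) :
    compCell Φ (compCell Ψ χ h₁ h₂) h₃ h₄ = compCell Ξ χ h₅ h₆ := by
  subst hk hl h₁ h₂ h₃ h₄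
  exact compCell_assoc Φ Ψ Ξ χ h

theorem comp_single_comp {A B A' B' A'' B'' A₀ B₀ : X} {f : A ⟶ A'} {f' : A' ⟶ A''}
    {f'' : A'' ⟶ A₀} {g : B ⟶ B'} {g' : B' ⟶ B''} {g'' : B'' ⟶ B₀}
    {ps : Chain A B} {qs : Chain A' B'} {r : Loose A'' B''}
    {m : A' ⟶ A₀} {n : B' ⟶ B₀} {x : A ⟶ A₀} {y : B ⟶ B₀}
    {s : Loose A₀ B₀} (Φ : Cells f ps qs g) (ψ : Cell f' qs r g')
    (χ : Cell f'' (.single r) s g'')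
    (h₁ : f' ≫ f'' = m) (h₂ : g' ≫ g'' = n) (h₃ : f ≫ m = x) (h₄ : g ≫ n = y) :
    compCell Φ (compCell (.single ψ) χ h₁ h₂) h₃ h₄ =
      compCell (.single (compCell Φ ψ rfl rfl)) χ
        (by rw [Category.assoc, h₁, h₃]) (by rw [Category.assoc, h₂, h₄]) :=
  comp_assoc' _ _ _ _ (isComp_cons_nil _ _ _ _ _ _ _ _) rfl rfl _ _ _ _ _ _

theorem id_comp' {A B A' B' : X} {f : A ⟶ A'} {ps : Chain A B} {q : Loose A' B'}
    {g : B ⟶ B'} (φ : Cell f ps q g) (h₁ : 𝟙 A ≫ f = f) (h₂ : 𝟙 B ≫ g = g) :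
    compCell (Cells.id ps) φ h₁ h₂ = φ := id_compCell φ

theorem single_id_comp {A B A' B' : X} {f : A ⟶ A'} {p : Loose A B} {q : Loose A' B'}
    {g : B ⟶ B'} (φ : Cell f (.single p) q g) (h₁ : 𝟙 A ≫ f = f) (h₂ : 𝟙 B ≫ g = g) :
    compCell (Cells.single (idCell p)) φ h₁ h₂ = φ := id_compCell φ

end Lemmas

section Equipment
variable {X : Type u} [VirtualEquipment.{t, w, v, u} X]

/-- A 2-cell `p₁, …, pₙ ⇒ E(f, g)`.  By the universal property of the restriction `E(f, g)` this is
the same as a 2-cell into the loose-identity of `E` with the tight-cells `f` and `g` on its sides,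
which is the form used here.  For `n = 0` it is a 2-cell `f ⇒ g` between tight-cells. -/
abbrev HomCell {A B E : X} (f : A ⟶ E) (ps : Chain A B) (g : B ⟶ E) : Type t :=
  Cell f ps (unit E) g

/-- The loose-cell `E(f, g)`. -/
abbrev hom {A B E : X} (f : A ⟶ E) (g : B ⟶ E) : Loose A B := restr f (unit E) g

/-- The identity 2-cell on `E(f, g)`, as a 2-cell into `E(f, g)`. -/
def homCell {A B E : X} (f : A ⟶ E) (g : B ⟶ E) : HomCell f (.single (hom f g)) g :=
  restrCell f (unit E) g

theorem exists_lift {A B E C D : X} {f : A ⟶ E} {g : B ⟶ E} {h : C ⟶ A} {k : D ⟶ B} {x : C ⟶ E}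
    {y : D ⟶ E} {ps : Chain C D} (θ : HomCell x ps y) (hx : h ≫ f = x) (hy : k ≫ g = y) :
    ∃! θ' : Cell h ps (hom f g) k, compCell (Cells.single θ') (homCell f g) hx hy = θ := by
  subst hx hy
  exact restrCell_cartesian f (unit E) g h k ps θ

/-- The 2-cell into the restriction `E(f, g)` that corresponds to a 2-cell into `E(h ≫ f, k ≫ g)`. -/
noncomputable def lift {A B E C D : X} {f : A ⟶ E} {g : B ⟶ E} {h : C ⟶ A} {k : D ⟶ B} {x : C ⟶ E}
    {y : D ⟶ E} {ps : Chain C D} (θ : HomCell x ps y) (hx : h ≫ f = x) (hy : k ≫ g = y) :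
    Cell h ps (hom f g) k := (exists_lift θ hx hy).choose

theorem lift_comp {A B E C D : X} {f : A ⟶ E} {g : B ⟶ E} {h : C ⟶ A} {k : D ⟶ B} {x : C ⟶ E}
    {y : D ⟶ E} {ps : Chain C D} (θ : HomCell x ps y) (hx : h ≫ f = x) (hy : k ≫ g = y) :
    compCell (Cells.single (lift θ hx hy)) (homCell f g) hx hy = θ :=
  (exists_lift θ hx hy).choose_spec.1

theorem lift_unique {A B E C D : X} {f : A ⟶ E} {g : B ⟶ E} {h : C ⟶ A} {k : D ⟶ B} {x : C ⟶ E}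
    {y : D ⟶ E} {ps : Chain C D} {θ : HomCell x ps y} (hx : h ≫ f = x) (hy : k ≫ g = y)
    {θ' : Cell h ps (hom f g) k}
    (e : compCell (Cells.single θ') (homCell f g) hx hy = θ) : lift θ hx hy = θ' :=
  (exists_lift θ hx hy).unique (lift_comp θ hx hy) e

theorem hom_ext {A B E C D : X} {f : A ⟶ E} {g : B ⟶ E} {h : C ⟶ A} {k : D ⟶ B} {x : C ⟶ E}
    {y : D ⟶ E} {ps : Chain C D} (hx : h ≫ f = x) (hy : k ≫ g = y)
    {θ θ' : Cell h ps (hom f g) k}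
    (e : compCell (Cells.single θ) (homCell f g) hx hy =
      compCell (Cells.single θ') (homCell f g) hx hy) : θ = θ' :=
  (exists_lift _ hx hy).unique e rfl

/-- The identity 2-cell on a tight-cell `f`. -/
def idHom {A E : X} (f : A ⟶ E) : HomCell f (.nil A) f :=
  compCell (Cells.nil (rfl : f = f)) (unitCell E) (Category.comp_id f) (Category.comp_id f)

/-- The composition 2-cell `E(1, 1), E(1, 1) ⇒ E(1, 1)`. -/
noncomputable def mulCell (E : X) :
    Cell (𝟙 E) (.cons (unit E) (.single (unit E))) (unit E) (𝟙 E) :=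
  (unitCell_opcartesian E (.nil E) (.single (unit E)) (𝟙 E) (unit E) (𝟙 E)
    (idCell (unit E))).choose

theorem mulCell_left (E : X) (h₁ h₂) : compCell (Cells.cons (unitCell E) (.single (idCell (unit E))) rfl)
    (mulCell E) h₁ h₂ = idCell (unit E) :=
  (unitCell_opcartesian E (.nil E) (.single (unit E)) (𝟙 E) (unit E) (𝟙 E)
    (idCell (unit E))).choose_spec.1

/-- The composite of `α : p₁, …, pₘ ⇒ E(f, g)` and `β : q₁, …, qₙ ⇒ E(g, h)`, a 2-cell
`p₁, …, pₘ, q₁, …, qₙ ⇒ E(f, h)`. -/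
noncomputable def mul {A B C E : X} {f : A ⟶ E} {g : B ⟶ E} {h : C ⟶ E} {ps : Chain A B}
    {qs : Chain B C} (α : HomCell f ps g) (β : HomCell g qs h) : HomCell f (ps.append qs) h :=
  compCell (Cells.cons α (.single β) rfl) (mulCell E) (Category.comp_id f) (Category.comp_id h)

/-- The action `D(1, 1) ⇒ E(r, r)` of a tight-cell `r : D ⟶ E`. -/
noncomputable def mapCell {D E : X} (r : D ⟶ E) : Cell r (.single (unit D)) (unit E) r :=
  (unitCell_opcartesian D (.nil D) (.nil D) r (unit E) r (idHom r)).choose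

theorem mapCell_unit {D E : X} (r : D ⟶ E) :
    compCell (Cells.single (unitCell D)) (mapCell r) (Category.id_comp r) (Category.id_comp r) = idHom r :=
  (unitCell_opcartesian D (.nil D) (.nil D) r (unit E) r (idHom r)).choose_spec.1

/-- The 2-cell `p₁, …, pₙ ⇒ E(f ≫ r, g ≫ r)` obtained from a 2-cell `p₁, …, pₙ ⇒ D(f, g)` by
postcomposing `r : D ⟶ E`. -/
noncomputable def map {A B D E : X} {f : A ⟶ D} {g : B ⟶ D} {ps : Chain A B} (α : HomCell f ps g)
    (r : D ⟶ E) {x : A ⟶ E} {y : B ⟶ E} (hx : f ≫ r = x) (hy : g ≫ r = y) : HomCell x ps y :=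
  compCell (Cells.single α) (mapCell r) hx hy

section
variable {A B C D E : X}

theorem comp_mul {A' B' C' : X} {f : A' ⟶ E} {g : B' ⟶ E} {h : C' ⟶ E} {ps : Chain A' B'}
    {qs : Chain B' C'} {a : A ⟶ A'} {b : B ⟶ B'} {c : C ⟶ C'} {ps' : Chain A B} {qs' : Chain B C}
    {x : A ⟶ E} {y : C ⟶ E} {z : B ⟶ E}
    (Φ : Cells a ps' ps b) (Ψ : Cells b qs' qs c) (α : HomCell f ps g) (β : HomCell g qs h)
    (hx : a ≫ f = x) (hy : c ≫ h = y) (hz : b ≫ g = z) :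
    compCell (Φ.append Ψ) (mul α β) hx hy = mul (compCell Φ α hx hz) (compCell Ψ β hz hy) :=
  comp_assoc' _ _ _ _ (.cons _ _ _ _ _ _ _ (isComp_cons_nil _ _ _ _ _ _ _ _)) hx hy _ _ _ _ _ _

theorem unit_ext {A' B' : X} {rs : Chain A B} {f : A ⟶ A'} {s : Loose A' B'} {g : B ⟶ B'}
    {θ θ' : Cell f (.cons (unit A) rs) s g}
    (e : compCell (Cells.cons (unitCell A) (Cells.id rs) rfl) θ (Category.id_comp f)
      (Category.id_comp g) = compCell (Cells.cons (unitCell A) (Cells.id rs) rfl) θ'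
      (Category.id_comp f) (Category.id_comp g)) : θ = θ' :=
  (unitCell_opcartesian A (.nil A) rs f s g _).unique e rfl

theorem comp_of_eq {A B A' B' A'' B'' A₀ B₀ : X} {f : A ⟶ A'} {f' : A' ⟶ A''} {f'' : A'' ⟶ A₀}
    {g : B ⟶ B'} {g' : B' ⟶ B''} {g'' : B'' ⟶ B₀}
    {ps : Chain A B} {qs : Chain A' B'} {rs : Chain A'' B''}
    {k : A ⟶ A''} {l : B ⟶ B''} {m : A' ⟶ A₀} {n : B' ⟶ B₀} {x : A ⟶ A₀} {y : B ⟶ B₀}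
    {s : Loose A₀ B₀} {Φ : Cells f ps qs g} {Ψ : Cells f' qs rs g'}
    {Ξ : Cells k ps rs l} {χ : Cell f'' rs s g''} {ω : Cell m qs s n}
    {h₁ : f' ≫ f'' = m} {h₂ : g' ≫ g'' = n}
    (hω : compCell Ψ χ h₁ h₂ = ω)
    (h : Cells.IsComp Φ Ψ Ξ)
    {h₅ : k ≫ f'' = x} {h₆ : l ≫ g'' = y}
    (hk : f ≫ f' = k) (hl : g ≫ g' = l) (h₃ : f ≫ m = x) (h₄ : g ≫ n = y) :
    compCell Ξ χ h₅ h₆ = compCell Φ ω h₃ h₄ := by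
  rw [← hω]
  exact (comp_assoc' Φ Ψ Ξ χ h hk hl h₁ h₂ h₃ h₄ h₅ h₆).symm

theorem isComp_single {A B A' B' A'' B'' : X} {f : A ⟶ A'} {ps : Chain A B}
    {qs : Chain A' B'} {g : B ⟶ B'} {f' : A' ⟶ A''} {r : Loose A'' B''} {g' : B' ⟶ B''}
    {k : A ⟶ A''} {l : B ⟶ B''}
    {Φ : Cells f ps qs g} {ψ : Cell f' qs r g'} {χ : Cell k ps r l} {hk : f ≫ f' = k} {hl : g ≫ g' = l}
    (e : compCell Φ ψ hk hl = χ) :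
    Cells.IsComp Φ (Cells.single ψ) (Cells.single χ) := by
  subst e
  exact isComp_cons_nil _ _ _ _ _ _ _ _

theorem isComp_cons {A B C A' B' C' A'' B'' C'' : X} {f : A ⟶ A'} {g : B ⟶ B'} {h : C ⟶ C'}
      {f' : A' ⟶ A''} {g' : B' ⟶ B''} {h' : C' ⟶ C''} {k : A ⟶ A''} {l : B ⟶ B''} {m : C ⟶ C''}
      {ps₁ : Chain A B} {ps₂ : Chain B C} {qs₁ : Chain A' B'} {qs₂ : Chain B' C'}
      {r : Loose A'' B''} {rs : Chain B'' C''}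
      (Φ₁ : Cells f ps₁ qs₁ g) {Φ₂ : Cells g ps₂ qs₂ h}
      {ψ : Cell f' qs₁ r g'} {Ψ : Cells g' qs₂ rs h'} {Ξ : Cells l ps₂ rs m} {χ : Cell k ps₁ r l}
      {hk : f ≫ f' = k} {hl : g ≫ g' = l} (e : compCell Φ₁ ψ hk hl = χ)
      (i : Cells.IsComp Φ₂ Ψ Ξ) :
      Cells.IsComp (Φ₁.append Φ₂) (.cons ψ Ψ rfl) (.cons χ Ξ rfl) := by
  subst e
  exact .cons _ _ _ _ _ _ _ i

theorem idHom_mul {f : A ⟶ E} {g : B ⟶ E} {ps : Chain A B} (α : HomCell f ps g) :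
    mul (idHom f) α = α :=
  (comp_of_eq (mulCell_left E (Category.comp_id _) (Category.comp_id _))
    (isComp_cons (.nil rfl) rfl (isComp_single (Φ := .single α) (compCell_id α)))
    (Category.comp_id f) (Category.comp_id g)
    (Category.comp_id f) (Category.comp_id g)).trans (compCell_id α)

theorem mulCell_right (E : X) (h₁ h₂ : 𝟙 E ≫ 𝟙 E = 𝟙 E) :
    compCell (Cells.cons (idCell (unit E)) (.cons (unitCell E) (.nil rfl) rfl) rfl)
      (mulCell E) h₁ h₂ = idCell (unit E) := by
  apply unit_ext
  have e₁ : compCell (.cons (unitCell E) (.single (unitCell E)) rfl) (mulCell E) h₁ h₂ =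
      unitCell E :=
    (comp_of_eq (mulCell_left E h₁ h₂)
      (isComp_cons (hk := h₁) (hl := h₁) (.nil rfl) (id_comp' _ h₁ h₁)
        (isComp_single (Φ := .single (unitCell E)) (compCell_id _)))
      h₁ h₁ h₁ h₁).trans (compCell_id _)
  refine (comp_assoc' _ _ _ _ (isComp_cons (.single (unitCell E)) (compCell_id _)
    (isComp_single (Φ := .nil rfl) (hk := h₁) (hl := h₁) (id_comp' _ h₁ h₁)))
    h₁ h₁ h₁ h₁ h₁ h₁ h₁ h₁).trans ?_
  exact e₁.trans (compCell_id _).symm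

theorem mulCell_assoc (E : X) (h₁ h₂ h₃ h₄ : 𝟙 E ≫ 𝟙 E = 𝟙 E) :
    compCell (Cells.cons (mulCell E) (.single (idCell (unit E))) rfl) (mulCell E) h₁ h₂ =
    compCell (Cells.cons (idCell (unit E)) (.single (mulCell E)) rfl) (mulCell E) h₃ h₄ := by
  apply unit_ext
  have e₁ : Cells.IsComp (.cons (unitCell E) (Cells.id (.cons (unit E) (.single (unit E)))) rfl)
      (Cells.cons (mulCell E) (.single (idCell (unit E))) rfl)
      (Cells.cons (idCell (unit E)) (.single (idCell (unit E))) rfl) :=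
    isComp_cons (.cons (unitCell E) (Cells.single (idCell (unit E))) rfl)
      (mulCell_left E h₁ h₁) (isComp_single (Φ := .single (idCell _)) (compCell_id _))
  refine (comp_assoc' _ _ _ _ e₁ h₁ h₁ h₁ h₁ h₁ h₁ h₁ h₁).trans ?_
  have e₂ : Cells.IsComp (.cons (unitCell E) (Cells.id (.cons (unit E) (.single (unit E)))) rfl)
      (Cells.cons (idCell (unit E)) (.single (mulCell E)) rfl)
      (Cells.cons (unitCell E) (.single (mulCell E)) rfl) :=
    isComp_cons (.single (unitCell E)) (compCell_id _)
      (isComp_single (Φ := Cells.id (.cons (unit E) (.single (unit E)))) (id_compCell _))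
  refine Eq.trans ?_ (comp_assoc' _ _ _ _ e₂ h₁ h₁ h₁ h₁ h₁ h₁ h₁ h₁).symm
  have e₃ : compCell (.cons (unitCell E) (.single (mulCell E)) rfl) (mulCell E) h₁ h₁ =
      mulCell E :=
    (comp_of_eq (mulCell_left E h₁ h₂)
      (isComp_cons (hk := h₁) (hl := h₁) (.nil rfl) (id_comp' _ h₁ h₁)
        (isComp_single (Φ := .single (mulCell E)) (compCell_id _)))
      h₁ h₁ h₁ h₁).trans (compCell_id _)
  exact (id_comp' (ps := .cons (unit E) (.single (unit E))) (mulCell E) h₁ h₁).trans e₃.symm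

theorem mul_assoc {f : A ⟶ E} {g : B ⟶ E} {h : C ⟶ E} {k : D ⟶ E} {ps : Chain A B}
    {qs : Chain B C} {rs : Chain C D} {ts : Chain A D}
    (α : HomCell f ps g) (β : HomCell g qs h)
    (γ : HomCell h rs k) (e₁ : (ps.append qs).append rs = ts) (e₂ : ps.append (qs.append rs) = ts)
    (hx : f ≫ 𝟙 E = f) (hy : k ≫ 𝟙 E = k) :
    compCell (.cons (mul α β) (.single γ) e₁) (mulCell E) hx hy =
    compCell (.cons α (.single (mul β γ)) e₂) (mulCell E) hx hy := by
  have hid : 𝟙 E ≫ 𝟙 E = 𝟙 E := Category.comp_id _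
  have i₁ : Cells.IsComp (.cons α (.cons β (.single γ) rfl) e₂)
      (Cells.cons (idCell (unit E)) (.single (mulCell E)) rfl)
      (Cells.cons α (.single (mul β γ)) e₂) := by
    subst e₂
    exact isComp_cons (.single α) (compCell_id _)
      (isComp_single (Φ := .cons β (.single γ) rfl) rfl)
  have i₂ : Cells.IsComp (.cons α (.cons β (.single γ) rfl) e₂)
      (Cells.cons (mulCell E) (.single (idCell (unit E))) rfl)
      (Cells.cons (mul α β) (.single γ) e₁) := by
    subst e₁
    exact isComp_cons (.cons α (.single β) rfl) rfl
      (isComp_single (Φ := .single γ) (compCell_id γ))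
  refine Eq.trans ?_ (comp_assoc' _ _ _ _ i₁ hx hy hid hid hx hy hx hy)
  refine (comp_assoc' _ _ _ _ i₂ hx hy hid hid hx hy hx hy).symm.trans ?_
  exact congrArg (fun z => compCell _ z hx hy) (mulCell_assoc E hid hid hid hid)

theorem mulCell_map (r : D ⟶ E) (h₁ : 𝟙 D ≫ r = r) (h₂ : r ≫ 𝟙 E = r) :
    compCell (.single (mulCell D)) (mapCell r) h₁ h₁ =
      compCell (.cons (mapCell r) (.single (mapCell r)) rfl) (mulCell E) h₂ h₂ := by
  have hid : 𝟙 D ≫ 𝟙 D = 𝟙 D := Category.comp_id _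
  apply unit_ext
  refine (comp_assoc' _ _ _ _ (isComp_single (mulCell_left D hid hid))
    hid hid h₁ h₁ h₁ h₁ h₁ h₁).trans ?_
  refine (single_id_comp _ _ _).trans ?_
  refine Eq.trans ?_ (comp_assoc' _ _ _ _ (isComp_cons (hk := h₁) (hl := h₁)
    (.single (unitCell D)) (mapCell_unit r)
    (isComp_single (Φ := Cells.id (.single (unit D))) (hk := h₁) (hl := h₁)
      (single_id_comp _ _ _)))
    h₁ h₁ h₂ h₂ h₁ h₁ h₂ h₂).symm
  exact (idHom_mul (mapCell r)).symm

theorem map_mul {f : A ⟶ D} {g : B ⟶ D} {h : C ⟶ D} {ps : Chain A B}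
    {qs : Chain B C} {x : A ⟶ E} {y : C ⟶ E} {z : B ⟶ E}
    (α : HomCell f ps g) (β : HomCell g qs h) (r : D ⟶ E)
    (hx : f ≫ r = x) (hy : h ≫ r = y) (hz : g ≫ r = z) :
    map (mul α β) r hx hy = mul (map α r hx hz) (map β r hz hy) := by
  have h₁ : 𝟙 D ≫ r = r := Category.id_comp _
  have h₂ : r ≫ 𝟙 E = r := Category.comp_id _
  refine (comp_assoc' _ _ _ _ (isComp_single rfl) (Category.comp_id f) (Category.comp_id h) h₁ h₁
    hx hy hx hy).symm.trans ?_
  refine (congrArg (fun z => compCell _ z hx hy) (mulCell_map r h₁ h₂)).trans ?_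
  exact comp_assoc' _ _ _ _ (isComp_cons (hk := hx) (hl := hz) (.single α) rfl
    (isComp_single (hk := hz) (hl := hy) (Φ := .single β) rfl)) hx hy h₂ h₂ hx hy
    (Category.comp_id _) (Category.comp_id _)

theorem idHom_map {A : X} (f : A ⟶ D) (r : D ⟶ E) {x : A ⟶ E} (hx hx' : f ≫ r = x) :
    map (idHom f) r hx hx' = idHom x := by
  have h₁ : 𝟙 D ≫ r = r := Category.id_comp _
  have h₂ : r ≫ 𝟙 E = r := Category.comp_id _
  have h₃ : x ≫ 𝟙 E = x := Category.comp_id _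
  refine (comp_assoc' (.nil rfl) _ _ _ (isComp_single rfl) (Category.comp_id f) (Category.comp_id f)
    h₁ h₁ hx hx hx hx).symm.trans ?_
  refine (congrArg (fun z => compCell (.nil rfl) z hx hx) (mapCell_unit r)).trans ?_
  exact comp_assoc' _ _ _ _ (.nil _ _ rfl hx) hx hx h₂ h₂ hx hx h₃ h₃

theorem comp_map {A' B' : X} {f : A' ⟶ D} {g : B' ⟶ D} {ps : Chain A' B'} {ps' : Chain A B}
    {a : A ⟶ A'} {b : B ⟶ B'} (Φ : Cells a ps' ps b) (α : HomCell f ps g) (r : D ⟶ E)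
    {x : A' ⟶ E} {y : B' ⟶ E} {x' : A ⟶ E} {y' : B ⟶ E} {x'' : A ⟶ D} {y'' : B ⟶ D}
    (hx : f ≫ r = x) (hy : g ≫ r = y) (hx' : a ≫ x = x') (hy' : b ≫ y = y')
    (hx'' : a ≫ f = x'') (hy'' : b ≫ g = y'') :
    compCell Φ (map α r hx hy) hx' hy' =
      map (compCell Φ α hx'' hy'') r (by rw [← hx'', Category.assoc, hx, hx'])
        (by rw [← hy'', Category.assoc, hy, hy']) := by
  subst hx'' hy''
  exact comp_single_comp Φ α (mapCell r) hx hy hx' hy'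

theorem mul_idHom {f : A ⟶ E} {g : B ⟶ E} {ps : Chain A B} (α : HomCell f ps g)
    (h₁ : f ≫ 𝟙 E = f) (h₂ : g ≫ 𝟙 E = g) :
    compCell (.cons α (.single (idHom g)) ps.append_nil) (mulCell E) h₁ h₂ = α := by
  have h₃ : 𝟙 E ≫ 𝟙 E = 𝟙 E := Category.comp_id _
  have i : ∀ {ts : Chain A B} (e : ps.append (.nil B) = ts),
      Cells.IsComp (.cons α (.nil rfl) e : Cells f ts (.single (unit E)) g)
        (.cons (idCell (unit E)) (.cons (unitCell E) (.nil rfl) rfl) rfl)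
        (.cons α (.single (idHom g)) e) := by
    intro ts e
    subst e
    exact isComp_cons (hk := h₁) (hl := h₂) (.single α) (compCell_id α)
      (isComp_single (Φ := .nil rfl) (hk := h₂) (hl := h₂) rfl)
  exact (comp_of_eq (mulCell_right E h₃ h₃) (i ps.append_nil) h₁ h₂ h₁ h₂).trans (compCell_id α)

end

end Equipment

section Relative
variable {X : Type u} [VirtualEquipment.{t, w, v, u} X] {A B C D E : X}

/-- Given an operator `a : E(j, e) ⇒ E(t, e)`, the 2-cell `p₁, …, pₙ ⇒ E(t, x)` obtained from a
2-cell `α : p₁, …, pₙ ⇒ E(j, x)`, where `x = c ≫ e`, by postcomposing `a(1, c)`. -/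
noncomputable def extend {j t : A ⟶ E} {e : D ⟶ E} (a : HomCell t (.single (hom j e)) e)
    {ps : Chain A B} {x : B ⟶ E} (α : HomCell j ps x) (c : B ⟶ D) (hc : c ≫ e = x) :
    HomCell t ps x :=
  compCell (.single (lift α (Category.id_comp j) hc)) a (Category.id_comp t) hc

theorem extend_homCell {j t : A ⟶ E} {e : D ⟶ E} (a : HomCell t (.single (hom j e)) e)
    (h : 𝟙 D ≫ e = e) : extend a (homCell j e) (𝟙 D) h = a := by
  have : lift (homCell j e) (Category.id_comp j) h = idCell (hom j e) :=
    lift_unique _ _ (single_id_comp _ _ _)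
  unfold extend
  rw [this]
  exact single_id_comp _ _ _

theorem comp_lift {A' B' : X} {f : C ⟶ E} {g : D ⟶ E} {h : A ⟶ C} {k : B ⟶ D} {x : A ⟶ E}
    {y : B ⟶ E} {ps : Chain A B} (θ : HomCell x ps y) (hx : h ≫ f = x) (hy : k ≫ g = y)
    {qs : Chain A' B'} {a : A' ⟶ A} {b : B' ⟶ B} (Φ : Cells a qs ps b) {h' : A' ⟶ C} {k' : B' ⟶ D}
    {x' : A' ⟶ E} {y' : B' ⟶ E} (h₁ : a ≫ h = h') (h₂ : b ≫ k = k') (h₃ : a ≫ x = x')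
    (h₄ : b ≫ y = y') :
    compCell Φ (lift θ hx hy) h₁ h₂ =
      lift (compCell Φ θ h₃ h₄) (by rw [← h₁, Category.assoc, hx, h₃])
        (by rw [← h₂, Category.assoc, hy, h₄]) := by
  subst h₁ h₂
  refine (lift_unique _ _ ?_).symm
  refine (comp_single_comp Φ (lift θ hx hy) (homCell f g) hx hy h₃ h₄).symm.trans ?_
  rw [lift_comp]

theorem comp_extend {j t : A ⟶ E} {e : D ⟶ E} (a : HomCell t (.single (hom j e)) e)
    {ps : Chain A B} {x : B ⟶ E} (α : HomCell j ps x) (c : B ⟶ D) (hc : c ≫ e = x)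
    {qs : Chain A C} {b : C ⟶ B} (Φ : Cells (𝟙 A) qs ps b) {c' : C ⟶ D} {x' : C ⟶ E}
    (h₁ : b ≫ x = x') (h₂ : b ≫ c = c') :
    compCell Φ (extend a α c hc) (Category.id_comp t) h₁ =
      extend a (compCell Φ α (Category.id_comp j) h₁) c'
        (by rw [← h₂, Category.assoc, hc, h₁]) := by
  subst h₂
  refine (comp_assoc' _ _ _ _ (isComp_single (hk := Category.id_comp _)
    (comp_lift α _ hc Φ (Category.id_comp _) rfl (Category.id_comp _) h₁))
    (Category.id_comp _) rfl _ _ _ _ (Category.id_comp _) _)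

/-- A 2-cell `C(ℓ, 1) ⇒ E(m, r)` is determined by its restriction along the identity of `ℓ`. -/
theorem yoneda {m : A ⟶ E} {ℓ : A ⟶ C} {r : C ⟶ E} (χ : HomCell m (.single (hom ℓ (𝟙 C))) r)
    {t : A ⟶ E} (ht : ℓ ≫ r = t) (h₁ : 𝟙 A ≫ m = m) (h₂ : 𝟙 C ≫ r = r)
    (h₃ : 𝟙 A ≫ ℓ = ℓ) (h₄ : ℓ ≫ 𝟙 C = ℓ) :
    mul (compCell (.single (lift (idHom ℓ) h₃ h₄)) χ h₁ ht) (map (homCell ℓ (𝟙 C)) r ht h₂) = χ := by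
  have hC : 𝟙 C ≫ 𝟙 C = 𝟙 C := Category.comp_id _
  have hA : 𝟙 A ≫ 𝟙 A = 𝟙 A := Category.comp_id _
  have hmE : m ≫ 𝟙 E = m := Category.comp_id _
  have hrE : r ≫ 𝟙 E = r := Category.comp_id _
  let ρ := homCell ℓ (𝟙 C)
  let W : HomCell ℓ (.cons (hom ℓ (𝟙 C)) (.single (unit C))) (𝟙 C) := mul ρ (idCell (unit C))
  let act := lift W h₃ hC
  have hu : idHom (𝟙 C) = unitCell C := id_comp' _ _ _
  let I : Cells (𝟙 A) (.single (hom ℓ (𝟙 C))) (.cons (hom ℓ (𝟙 C)) (.single (unit C))) (𝟙 C) :=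
    .cons (idCell _) (.single (unitCell C)) rfl
  have e₁ : compCell I act hA hC = idCell _ := by
    refine hom_ext h₃ hC ?_
    refine (comp_assoc' I (.single act) _ _ (isComp_single rfl) hA hC h₃ hC h₃ hC h₃ hC).symm.trans
      ?_
    refine (congrArg (fun z => compCell I z h₃ hC) (lift_comp W h₃ hC)).trans ?_
    refine (comp_mul (.single (idCell _)) (.single (unitCell C)) ρ (idCell (unit C)) h₃ hC
      hC).trans ?_
    refine (congrArg₂ mul (single_id_comp ρ h₃ hC)
      ((compCell_id (unitCell C)).trans hu.symm)).trans ?_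
    exact (mul_idHom ρ h₄ hC).trans (single_id_comp ρ h₃ hC).symm
  have e₂ : mul χ (mapCell r) = compCell (.single act) χ h₁ h₂ := by
    refine (unitCell_opcartesian C (.single (hom ℓ (𝟙 C))) (.nil C) m (unit E) r χ).unique
      (y₁ := mul χ (mapCell r)) (y₂ := compCell (.single act) χ h₁ h₂) ?_ ?_
    · refine (comp_mul (.single (idCell _)) (.single (unitCell C)) χ (mapCell r) h₁ h₂
        h₂).trans ?_
      refine (congrArg₂ mul (single_id_comp χ h₁ h₂) (mapCell_unit r)).trans ?_
      exact mul_idHom χ hmE hrE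
    · refine (comp_assoc' I (.single act) _ χ (isComp_single e₁) hA hC h₁ h₂ h₁ h₂ h₁ h₂).trans ?_
      exact single_id_comp χ h₁ h₂
  let L : Cell (𝟙 A) (.nil A) (hom ℓ (𝟙 C)) ℓ := lift (idHom ℓ) h₃ h₄
  let J : Cells (𝟙 A) (.single (hom ℓ (𝟙 C))) (.cons (hom ℓ (𝟙 C)) (.single (unit C))) (𝟙 C) :=
    .cons L (.single ρ) rfl
  have e₃ : compCell J act hA hC = idCell _ := by
    refine hom_ext h₃ hC ?_
    refine (comp_assoc' J (.single act) _ _ (isComp_single rfl) hA hC h₃ hC h₃ hC h₃ hC).symm.trans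
      ?_
    refine (congrArg (fun z => compCell J z h₃ hC) (lift_comp W h₃ hC)).trans ?_
    refine (comp_mul (.single L) (.single ρ) ρ (idCell (unit C)) h₃ hC h₄).trans ?_
    refine (congrArg₂ mul (lift_comp (idHom ℓ) h₃ h₄) (compCell_id ρ)).trans ?_
    exact (idHom_mul ρ).trans (single_id_comp ρ h₃ hC).symm
  refine (comp_mul (.single L) (.single ρ) χ (mapCell r) h₁ h₂ ht).symm.trans ?_
  refine (congrArg (fun z => compCell J z h₁ h₂) e₂).trans ?_
  refine (comp_assoc' J (.single act) _ χ (isComp_single e₃) hA hC h₁ h₂ h₁ h₂ h₁ h₂).trans ?_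
  exact single_id_comp χ h₁ h₂

end Relative

section Monads
variable {X : Type u} [VirtualEquipment.{t, w, v, u} X] {A B C D E : X}

/-- A monad relative to the root `j`: a carrier `t`, an extension operator `E(j, t) ⇒ E(t, t)` and a
unit `j ⇒ t`, subject to two unit laws and an associativity law. -/
structure RelativeMonad (j : A ⟶ E) where
  carrier : A ⟶ E
  ext : HomCell carrier (.single (hom j carrier)) carrier
  unit : HomCell j (.nil A) carrier
  unit_ext : mul unit ext = homCell j carrier
  ext_unit : extend ext unit (𝟙 A) (Category.id_comp carrier) = idHom carrier
  ext_ext : extend ext (mul (homCell j carrier) ext) (𝟙 A) (Category.id_comp carrier) = mul ext ext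

/-- An algebra with domain `D` for a relative monad: a carrier `e : D ⟶ E` and an extension operator
`E(j, e) ⇒ E(t, e)`, compatible with the unit and with the extension operator of the monad. -/
structure RelativeMonad.Algebra {j : A ⟶ E} (T : RelativeMonad j) (D : X) where
  carrier : D ⟶ E
  act : HomCell T.carrier (.single (hom j carrier)) carrier
  unit_act : mul T.unit act = homCell j carrier
  ext_act : extend act (mul (homCell j T.carrier) act) (𝟙 D) (Category.id_comp carrier) =
    mul T.ext act

/-- A `j`-relative adjunction with right adjoint `r`: a left adjoint together with an isomorphism
of loose-cells between `C(left, 1)` and `E(j, r)`. -/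
structure RelativeAdjunction (j : A ⟶ E) (r : C ⟶ E) where
  left : A ⟶ C
  sharp : Cell (𝟙 A) (.single (hom left (𝟙 C))) (hom j r) (𝟙 C)
  flat : Cell (𝟙 A) (.single (hom j r)) (hom left (𝟙 C)) (𝟙 C)
  sharp_flat : compCell (.single sharp) flat (Category.comp_id _) (Category.comp_id _) = idCell _
  flat_sharp : compCell (.single flat) sharp (Category.comp_id _) (Category.comp_id _) = idCell _

theorem mul_extend {j t : A ⟶ E} {e : D ⟶ E} (a : HomCell t (.single (hom j e)) e)
    {s : C ⟶ E} {ps : Chain C A} (α : HomCell s ps t)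
    {qs : Chain A B} {x : B ⟶ E} (β : HomCell j qs x) (c : B ⟶ D) (hc : c ≫ e = x)
    (h₁ : 𝟙 C ≫ s = s) :
    mul α (extend a β c hc) =
      compCell ((Cells.id ps).append (.single (lift β (Category.id_comp j) hc))) (mul α a) h₁ hc :=
  ((comp_mul (Cells.id ps) _ α a h₁ hc (Category.id_comp t)).trans
    (congrArg (fun z => mul z _) (id_comp' α _ _))).symm

theorem unit_mul_extend {j t : A ⟶ E} {e : D ⟶ E} {a : HomCell t (.single (hom j e)) e}
    {η : HomCell j (.nil A) t} (h : mul η a = homCell j e)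
    {qs : Chain A B} {x : B ⟶ E} (β : HomCell j qs x) (c : B ⟶ D) (hc : c ≫ e = x) :
    mul η (extend a β c hc) = β := by
  refine (mul_extend a η β c hc (Category.id_comp j)).trans ?_
  refine (congrArg (fun z => compCell (.single (lift β (Category.id_comp j) hc)) z
    (Category.id_comp j) hc) h).trans ?_
  exact lift_comp β _ hc

theorem extend_extend {j t : A ⟶ E} {e : D ⟶ E} (a : HomCell t (.single (hom j e)) e)
    {x : C ⟶ E} (c : C ⟶ D) (hc : c ≫ e = x)
    {qs : Chain A B} {y : B ⟶ E} (β : HomCell j qs y) (d : B ⟶ C) (hd : d ≫ x = y)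
    {dc : B ⟶ D} (h : d ≫ c = dc) :
    extend (extend a (homCell j x) c hc) β d hd =
      extend a β dc (by rw [← h, Category.assoc, hc, hd]) := by
  refine (comp_extend a (homCell j x) c hc (.single (lift β (Category.id_comp j) hd)) hd h).trans ?_
  congr 1
  exact lift_comp β _ hd

namespace RelativeAdjunction
variable {j : A ⟶ E} {r : C ⟶ E} (adj : RelativeAdjunction j r)

/-- The unit `j ⇒ left ≫ r`, the transpose of the identity of the left adjoint. -/
noncomputable def unit : HomCell j (.nil A) (adj.left ≫ r) :=
  compCell (.single (lift (idHom adj.left) (Category.id_comp _) (Category.comp_id _)))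
    (compCell (.single adj.sharp) (homCell j r) (Category.id_comp j) (Category.id_comp r))
    (Category.id_comp j) rfl

/-- The operator `flat`, as a 2-cell `E(j, r) ⇒ C(left, 1)`. -/
noncomputable def untranspose : HomCell adj.left (.single (hom j r)) (𝟙 C) :=
  compCell (.single adj.flat) (homCell adj.left (𝟙 C)) (Category.id_comp _) (Category.id_comp _)

/-- The operator `E(j, r) ⇒ C(left, 1) ⇒ E(left ≫ r, r)`. -/
noncomputable def act : HomCell (adj.left ≫ r) (.single (hom j r)) r :=
  map adj.untranspose r rfl (Category.id_comp r)

/-- The extension operator of the induced relative monad, the restriction of `act` along the left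
adjoint. -/
noncomputable def ext : HomCell (adj.left ≫ r) (.single (hom j (adj.left ≫ r))) (adj.left ≫ r) :=
  extend adj.act (homCell j (adj.left ≫ r)) adj.left rfl

theorem unit_mul_map : mul adj.unit (map (homCell adj.left (𝟙 C)) r rfl (Category.id_comp r)) =
    compCell (.single adj.sharp) (homCell j r) (Category.id_comp j) (Category.id_comp r) :=
  yoneda _ rfl _ _ _ _

theorem act_eq : adj.act = compCell (.single adj.flat)
    (map (homCell adj.left (𝟙 C)) r rfl (Category.id_comp r)) (Category.id_comp _)
    (Category.id_comp r) :=
  (comp_map (.single adj.flat) _ r _ _ _ _ _ _).symm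

theorem comp_unit_mul {j t : A ⟶ E} {η : HomCell j (.nil A) t} {C' : X} {h : C' ⟶ E}
    {ps : Chain A C'} (β : HomCell t ps h) {C : X} {qs : Chain A C} {c : C ⟶ C'} {y : C ⟶ E}
    (Φ : Cells (𝟙 A) qs ps c) (hy : c ≫ h = y) :
    compCell Φ (mul η β) (Category.id_comp j) hy =
      mul η (compCell Φ β (Category.id_comp t) hy) :=
  (comp_mul (.nil rfl) Φ η β (Category.id_comp j) hy (Category.id_comp t)).trans
    (congrArg (fun z => mul z (compCell Φ β (Category.id_comp t) hy)) (id_comp' η _ _))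

theorem sharp_untranspose : compCell (.single adj.sharp) adj.untranspose (Category.id_comp _)
    (Category.id_comp _) = homCell adj.left (𝟙 C) :=
  (comp_assoc' _ _ _ _ (isComp_single adj.sharp_flat) (Category.id_comp _) (Category.id_comp _)
    _ _ _ _ (Category.id_comp _) (Category.id_comp _)).trans (single_id_comp _ _ _)

theorem unit_act : mul adj.unit adj.act = homCell j r := by
  rw [act_eq]
  refine (comp_unit_mul _ (.single adj.flat) (Category.id_comp r)).symm.trans ?_
  refine (congrArg (fun z => compCell (.single adj.flat) z (Category.id_comp j)
    (Category.id_comp r)) adj.unit_mul_map).trans ?_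
  refine (comp_assoc' _ _ _ _ (isComp_single adj.flat_sharp) (Category.id_comp _)
    (Category.id_comp _) _ _ _ _ (Category.id_comp _) (Category.id_comp _)).trans ?_
  exact single_id_comp _ _ _

theorem extend_act {ps : Chain A B} {x : B ⟶ E} (β : HomCell j ps x) (c : B ⟶ C) (hc : c ≫ r = x) :
    extend adj.act β c hc = map (compCell (.single (lift β (Category.id_comp j) hc))
      adj.untranspose (Category.id_comp _) (Category.comp_id c)) r rfl hc :=
  comp_map _ adj.untranspose r _ _ _ _ _ _

theorem unit_mul_ext : mul adj.unit adj.ext = homCell j (adj.left ≫ r) :=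
  unit_mul_extend adj.unit_act _ _ _

theorem ext_act : extend adj.act (mul (homCell j (adj.left ≫ r)) adj.act) (𝟙 C)
    (Category.id_comp r) = mul adj.ext adj.act := by
  have hA : 𝟙 A ≫ 𝟙 A = 𝟙 A := Category.comp_id _
  have hC : 𝟙 C ≫ 𝟙 C = 𝟙 C := Category.comp_id _
  have hr := Category.id_comp r
  have hj := Category.id_comp j
  have hl := Category.id_comp adj.left
  let β : HomCell j (.cons (hom j (adj.left ≫ r)) (.single (hom j r))) r :=
    mul (homCell j (adj.left ≫ r)) adj.act
  let φ' : HomCell adj.left (.single (hom j (adj.left ≫ r))) adj.left :=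
    compCell (.single (lift (homCell j (adj.left ≫ r)) hj rfl)) adj.untranspose hl
      (Category.comp_id _)
  let ω : HomCell adj.left (.cons (hom j (adj.left ≫ r)) (.single (hom j r))) (𝟙 C) :=
    mul φ' adj.untranspose
  have e₁ : mul adj.ext adj.act = map ω r rfl hr := by
    refine Eq.trans ?_ (map_mul φ' adj.untranspose r rfl hr rfl).symm
    exact congrArg (fun z => mul z adj.act) (adj.extend_act _ _ _)
  have e₂ : mul adj.unit (map ω r rfl hr) = β := by
    rw [← e₁]
    refine (mul_assoc adj.unit adj.ext adj.act rfl rfl (Category.comp_id _)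
      (Category.comp_id _)).symm.trans ?_
    exact congrArg (fun z => mul z adj.act) adj.unit_mul_ext
  have e₃ : compCell (.single (lift ω hl hC)) adj.sharp hA hC = lift β hj hr := by
    refine hom_ext hj hr ?_
    refine Eq.trans ?_ (lift_comp β hj hr).symm
    refine (comp_assoc' _ _ _ (homCell j r) (isComp_single rfl) hA hC hj hr hj hr hj hr).symm.trans
      ?_
    refine (congrArg (fun z => compCell (.single (lift ω hl hC)) z hj hr)
      adj.unit_mul_map).symm.trans ?_
    refine (comp_unit_mul _ (.single (lift ω hl hC)) hr).trans ?_
    refine Eq.trans ?_ e₂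
    refine congrArg (mul adj.unit) ?_
    refine (comp_map _ _ r _ _ _ _ hl hC).trans ?_
    exact congrArg (fun z => map z r rfl hr) (lift_comp ω hl hC)
  rw [e₁]
  refine (adj.extend_act β (𝟙 C) hr).trans ?_
  refine congrArg (fun z => map z r rfl hr) ?_
  rw [← e₃]
  refine (comp_assoc' _ _ _ _ (isComp_single rfl) hA hC hl hC hl hC hl hC).symm.trans ?_
  refine (congrArg (fun z => compCell (.single (lift ω hl hC)) z hl hC)
    adj.sharp_untranspose).trans ?_
  exact lift_comp ω hl hC

theorem ext_unit : extend adj.ext adj.unit (𝟙 A) (Category.id_comp _) = idHom (adj.left ≫ r) := by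
  have hA : 𝟙 A ≫ 𝟙 A = 𝟙 A := Category.comp_id _
  have hr := Category.id_comp r
  have hj := Category.id_comp j
  have hl := Category.id_comp adj.left
  have hl' := Category.comp_id adj.left
  refine (extend_extend _ _ _ _ _ _ (Category.id_comp _)).trans ?_
  refine (adj.extend_act _ _ _).trans ?_
  refine Eq.trans ?_ (idHom_map adj.left r rfl rfl)
  refine congrArg (fun z => map z r rfl rfl) ?_
  have e : lift adj.unit hj rfl =
      compCell (.single (lift (idHom adj.left) hl hl')) adj.sharp hA hl' := by
    refine lift_unique _ _ ?_
    exact (comp_assoc' _ _ _ _ (isComp_single rfl) hA hl' hj hr hj rfl hj rfl).symm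
  rw [e]
  refine (comp_assoc' _ _ _ _ (isComp_single rfl) hA hl' hl (Category.comp_id _) hl hl' hl
    hl').symm.trans ?_
  refine (congrArg (fun z => compCell (.single (lift (idHom adj.left) hl hl')) z hl hl')
    adj.sharp_untranspose).trans ?_
  exact lift_comp _ hl hl'

theorem ext_ext : extend adj.ext (mul (homCell j (adj.left ≫ r)) adj.ext) (𝟙 A)
    (Category.id_comp _) = mul adj.ext adj.ext := by
  refine (extend_extend _ _ _ _ _ _ (Category.id_comp adj.left)).trans ?_
  have hj := Category.id_comp j
  have hA : 𝟙 A ≫ 𝟙 A = 𝟙 A := Category.comp_id _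
  have ht := Category.id_comp (adj.left ≫ r)
  let Λ : Cells (𝟙 A) (.cons (hom j (adj.left ≫ r)) (.single (hom j (adj.left ≫ r))))
      (.cons (hom j (adj.left ≫ r)) (.single (hom j r))) adj.left :=
    (Cells.id (.single (hom j (adj.left ≫ r)))).append
      (.single (lift (homCell j (adj.left ≫ r)) hj rfl))
  have e₁ : mul adj.ext adj.ext = compCell Λ (mul adj.ext adj.act) ht rfl :=
    mul_extend _ _ _ _ _ _
  have e₂ : mul (homCell j (adj.left ≫ r)) adj.ext =
      compCell Λ (mul (homCell j (adj.left ≫ r)) adj.act) hj rfl :=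
    mul_extend _ _ _ _ _ _
  refine (congrArg (fun z => extend adj.act z adj.left rfl) e₂).trans ?_
  refine Eq.trans ?_ ((congrArg (fun z => compCell Λ z ht rfl) adj.ext_act).trans e₁.symm)
  exact (comp_extend adj.act _ (𝟙 C) (Category.id_comp r) Λ rfl (Category.comp_id adj.left)).symm

/-- The relative monad induced by a relative adjunction. -/
noncomputable def monad : RelativeMonad j where
  carrier := adj.left ≫ r
  ext := adj.ext
  unit := adj.unit
  unit_ext := adj.unit_mul_ext
  ext_unit := adj.ext_unit
  ext_ext := adj.ext_ext

/-- The algebra structure on the right adjoint of a relative adjunction. -/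
noncomputable def algebra : adj.monad.Algebra C where
  carrier := r
  act := adj.act
  unit_act := adj.unit_act
  ext_act := adj.ext_act

end RelativeAdjunction

end Monads

section Monadicity
variable {X : Type u} [VirtualEquipment.{t, w, v, u} X] {A B C D E W Y Z : X}

/-- A 2-cell `ε : p₁, …, pₙ ⇒ E(e, e')` is a `(p₁, …, pₙ)`-graded morphism of algebras. -/
def RelativeMonad.Algebra.IsMorphism {j : A ⟶ E} {T : RelativeMonad j} (a : T.Algebra C)
    (b : T.Algebra D) {ps : Chain C D} (ε : HomCell a.carrier ps b.carrier) : Prop :=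
  extend b.act (mul (homCell j a.carrier) ε) (𝟙 D) (Category.id_comp b.carrier) = mul a.act ε

/-- The tight-cell `c` exhibits the algebra `b` as the restriction of the algebra `a` along `c`: the
carrier of `b` is `c ≫ e` and its operator is `a(1, c)`. -/
structure RelativeMonad.Algebra.Factors {j : A ⟶ E} {T : RelativeMonad j} (a : T.Algebra C)
    (b : T.Algebra D) (c : D ⟶ C) : Prop where
  comp_carrier : c ≫ a.carrier = b.carrier
  extend_act : extend a.act (homCell j b.carrier) c comp_carrier = b.act

/-- Algebra objects: universal algebras, with respect to algebras and to graded morphisms. -/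
structure RelativeMonad.Algebra.IsAlgebraObject {j : A ⟶ E} {T : RelativeMonad j}
    (a : T.Algebra C) : Prop where
  existsUnique_tight : ∀ {D : X} (b : T.Algebra D), ∃! c : D ⟶ C, a.Factors b c
  existsUnique_cell : ∀ {D D' : X} {b : T.Algebra D} {b' : T.Algebra D'} {c : D ⟶ C} {c' : D' ⟶ C}
    (h : a.Factors b c) (h' : a.Factors b' c') (ps : Chain D D')
    (ε : HomCell b.carrier ps b'.carrier), b.IsMorphism b' ε →
    ∃! ε' : HomCell c ps c', map ε' a.carrier h.comp_carrier h'.comp_carrier = ε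

def RelativeMonad.HasAlgebraObject {j : A ⟶ E} (T : RelativeMonad j) : Prop :=
  ∃ (M : X) (a : T.Algebra M), a.IsAlgebraObject

/-- The unique tight-cell to an algebra object induced by an algebra. -/
noncomputable def RelativeMonad.Algebra.IsAlgebraObject.comparison {j : A ⟶ E}
    {T : RelativeMonad j} {a : T.Algebra C} (ha : a.IsAlgebraObject) (b : T.Algebra D) : D ⟶ C :=
  (ha.existsUnique_tight b).choose

/-- Strict relative monadicity: `r` has a left `j`-adjoint, the induced relative monad has an algebra
object, and the comparison tight-cell to it is an isomorphism. -/
def IsStrictlyMonadic (j : A ⟶ E) (r : D ⟶ E) : Prop :=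
  ∃ (adj : RelativeAdjunction j r) (M : X) (a : adj.monad.Algebra M) (ha : a.IsAlgebraObject),
    IsIso (ha.comparison adj.algebra)

/-- The `p`-cocone `γ : p ⇒ E(f, c)` exhibits `c` as the `p`-weighted colimit of `f`: pasting with `γ`
is a bijection between 2-cells `q₁, …, qₙ ⇒ E(c, 1)` and 2-cells `p, q₁, …, qₙ ⇒ E(f, 1)`. -/
def IsColimit {p : Loose Z Y} {f : Z ⟶ E} {c : Y ⟶ E} (γ : HomCell f (.single p) c) : Prop :=
  ∀ qs : Chain Y E, Function.Bijective
    (fun β : HomCell c qs (𝟙 E) => (mul γ β : HomCell f (.cons p qs) (𝟙 E)))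

/-- Density: the identity of `E`, with the identity 2-cell on `E(j, 1)`, is the left extension of `j`
along `j`, that is, the `E(j, 1)`-weighted colimit of `j`. -/
def IsDense (j : A ⟶ E) : Prop := IsColimit (p := hom j (𝟙 E)) (homCell j (𝟙 E))

/-- The canonical 2-cell `E(j, f), p ⇒ E(j, c)` given by pasting with a cocone `γ : p ⇒ E(f, c)`. -/
noncomputable def absoluteCell (j : A ⟶ E) {p : Loose Z Y} {f : Z ⟶ E} {c : Y ⟶ E}
    (γ : HomCell f (.single p) c) :
    Cell (𝟙 A) (.cons (hom j f) (.single p)) (hom j c) (𝟙 Y) :=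
  lift (mul (homCell j f) γ) (Category.id_comp j) (Category.id_comp c)

/-- The `j`-absolute colimits: the left-composite of `E(j, f), p` exists, and the canonical 2-cell from
it to `E(j, c)` is invertible. -/
def IsAbsolute (j : A ⟶ E) {p : Loose Z Y} {f : Z ⟶ E} {c : Y ⟶ E}
    (γ : HomCell f (.single p) c) : Prop :=
  ∃ (q : Loose A Y) (κ : Cell (𝟙 A) (.cons (hom j f) (.single p)) q (𝟙 Y))
    (θ : Cell (𝟙 A) (.single q) (hom j c) (𝟙 Y)),
    IsLeftOpcartesian κ ∧
    compCell (.single κ) θ (Category.comp_id _) (Category.comp_id _) = absoluteCell j γ ∧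
    IsInvertible θ

/-- The cocone `x` for `f` is sent by `g` to the cocone `(c, γ)` for `k = f ≫ g`. -/
def IsLiftOfCocone (g : W ⟶ E) {p : Loose Z Y} {f : Z ⟶ W} {k : Z ⟶ E} (hk : f ≫ g = k)
    {c : Y ⟶ E} (γ : HomCell k (.single p) c) (x : Σ d : Y ⟶ W, HomCell f (.single p) d) : Prop :=
  ∃ h : x.1 ≫ g = c, map x.2 g hk h = γ

/-- The tight-cell `g` strictly creates the colimit `(c, γ)` of `k = f ≫ g`: there is exactly one
cocone for `f` that `g` sends to `(c, γ)`, and it is a colimit of `f`. -/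
def StrictlyCreates (g : W ⟶ E) {p : Loose Z Y} {f : Z ⟶ W} {k : Z ⟶ E} (hk : f ≫ g = k)
    {c : Y ⟶ E} (γ : HomCell k (.single p) c) : Prop :=
  ∃ x : Σ d : Y ⟶ W, HomCell f (.single p) d,
    IsLiftOfCocone g hk γ x ∧ (∀ y, IsLiftOfCocone g hk γ y → y = x) ∧ IsColimit x.2

/-- The tight-cell `r` strictly creates `j`-absolute `r`-extensions, that is, those left extensions
of `r` along tight-cells `c : D ⟶ C`, or `C(c, 1)`-weighted colimits of `r = 𝟙 D ≫ r`, that are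
`j`-absolute. -/
def StrictlyCreatesAbsoluteExtensions (j : A ⟶ E) (r : D ⟶ E) : Prop :=
  ∀ ⦃C : X⦄ (c : D ⟶ C) (r' : C ⟶ E) (γ : HomCell r (.single (hom c (𝟙 C))) r'),
    IsColimit γ → IsAbsolute j γ → StrictlyCreates r (Category.id_comp r) γ

end Monadicity
end Equip

namespace Equip

open DoubleGraph VirtualDoubleStruct VirtualDoubleCategory VirtualEquipment

/-! Write ℓ for the left j-adjoint of r. Both directions are governed by the chain E(j, r), C(c, 1)
for a tight-cell c on D. Since E(j, r) ≅ D(ℓ, 1), this chain behaves like C(ℓ ≫ c, 1): inserting the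
unit of the adjunction in front and collapsing the old chain into C(c, 1) by transposition changes
no 2-cell out of the chain (`unitLift_compositorLift`). So a left-opcartesian 2-cell out of it is
split (`exists_section`), and a suitable splitting makes a 2-cell left-opcartesian
(`isLeftOpcartesian_of_section`).

If r is strictly monadic, then r is itself an algebra object. For a j-absolute extension r' of r
along c, the loose-cell E(j, r') is the left-composite of E(j, r), C(c, 1), so the operator of r
descends to an operator on r' and the cocone becomes a graded morphism. The universal property of r
lifts r' and the cocone to D uniquely. It also lifts the factorizations through the cocone, since
being a graded morphism can be tested after pasting with the cocone (`isMorphism_of_mul_cocone`).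

Conversely, let u be an algebra object and i the comparison. The operator of u is a graded morphism
out of the free algebra, so it lifts to a 2-cell E(j, u) ⇒ C(ℓ ≫ i, 1). This lift is the splitting
showing that u is a j-absolute extension of r along i, and density makes it a colimit. Creation then
gives i' with i' ≫ r = u. Uniqueness in the algebra object gives i' ≫ i = 1; uniqueness of lifts,
applied to the extension of r along the identity, gives i ≫ i' = 1. -/

section
variable {X : Type u} [VirtualEquipment.{t, w, v, u} X] {A B C D E F : X}

/-! ### Actions of loose-identities and naturality of 2-cells -/

theorem Cells.isComp_id {A B : X} (ps : Chain A B) :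
    Cells.IsComp (Cells.id ps) (Cells.id ps) (Cells.id ps) := by
  induction ps with
  | nil A => exact .nil _ _ _ (Category.comp_id _)
  | cons p ps ih => exact isComp_cons (.single (idCell p)) (compCell_id _) ih

theorem lift_homCell (f : A ⟶ E) (g : B ⟶ E) (h₁ : 𝟙 A ≫ f = f) (h₂ : 𝟙 B ≫ g = g) :
    lift (homCell f g) h₁ h₂ = idCell (hom f g) :=
  lift_unique _ _ (single_id_comp _ _ _)

theorem mapCell_id (D : X) : mapCell (𝟙 D) = idCell (unit D) := by
  have hid : 𝟙 D ≫ 𝟙 D = 𝟙 D := Category.comp_id _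
  apply unit_ext (rs := .nil D)
  refine (mapCell_unit (𝟙 D)).trans ?_
  exact (id_comp' (ps := .nil D) (unitCell D) hid hid).trans (compCell_id (unitCell D)).symm

theorem map_id {f : A ⟶ D} {g : B ⟶ D} {ps : Chain A B} (α : HomCell f ps g)
    (hf : f ≫ 𝟙 D = f) (hg : g ≫ 𝟙 D = g) : map α (𝟙 D) hf hg = α := by
  unfold map
  rw [mapCell_id]
  exact compCell_id α

theorem map_mapCell (r : C ⟶ D) (s : D ⟶ E) {k : C ⟶ E} (h h' : r ≫ s = k) :
    map (mapCell r) s h h' = mapCell k := by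
  subst h
  apply unit_ext (rs := .nil C)
  refine Eq.trans ?_ (mapCell_unit (r ≫ s)).symm
  refine (comp_map (.single (unitCell C)) (mapCell r) s _ _ _ _ (Category.id_comp r)
    (Category.id_comp r)).trans ?_
  refine Eq.trans ?_ (idHom_map r s rfl rfl)
  exact congrArg (fun z => map z s rfl rfl) (mapCell_unit r)

theorem map_map {f : A ⟶ C} {g : B ⟶ C} {ps : Chain A B} (α : HomCell f ps g) (r : C ⟶ D)
    (s : D ⟶ E) {k : C ⟶ E} (hk : r ≫ s = k) {x : A ⟶ D} {y : B ⟶ D} {x' : A ⟶ E} {y' : B ⟶ E}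
    (hx : f ≫ r = x) (hy : g ≫ r = y) (hx' : x ≫ s = x') (hy' : y ≫ s = y') :
    map (map α r hx hy) s hx' hy' =
      map α k (by rw [← hk, ← Category.assoc, hx, hx'])
        (by rw [← hk, ← Category.assoc, hy, hy']) := by
  subst hx hy
  refine (comp_map (.single α) (mapCell r) s hk hk (x' := x') (y' := y')
    (by rw [← hk, ← Category.assoc, hx']) (by rw [← hk, ← Category.assoc, hy']) rfl
    rfl).symm.trans ?_
  exact congrArg (fun z => compCell (.single α) z _ _) (map_mapCell r s hk hk)

/-- The action `E(j, e), D(1, 1) ⇒ E(j, e)`. -/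
noncomputable def rightAct (j : A ⟶ E) (e : D ⟶ E) :
    Cell (𝟙 A) (.cons (hom j e) (.single (unit D))) (hom j e) (𝟙 D) :=
  lift (mul (homCell j e) (mapCell e)) (Category.id_comp j) (Category.id_comp e)

/-- The action `D(1, 1), C(c, g) ⇒ C(c, g)`. -/
noncomputable def leftAct (c : D ⟶ C) (g : B ⟶ C) :
    Cell (𝟙 D) (.cons (unit D) (.single (hom c g))) (hom c g) (𝟙 B) :=
  lift (mul (mapCell c) (homCell c g)) (Category.id_comp c) (Category.id_comp g)

theorem unit_rightAct (j : A ⟶ E) (e : D ⟶ E) (hA : 𝟙 A ≫ 𝟙 A = 𝟙 A) (hD : 𝟙 D ≫ 𝟙 D = 𝟙 D) :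
    compCell (.cons (idCell (hom j e)) (.single (unitCell D)) rfl) (rightAct j e) hA hD =
      idCell (hom j e) := by
  have hj := Category.id_comp j
  have he := Category.id_comp e
  refine (comp_lift _ hj he _ hA hD hj he).trans (lift_unique _ _ ?_)
  refine (single_id_comp _ hj he).trans ?_
  refine (mul_idHom (homCell j e) (Category.comp_id _) (Category.comp_id _)).symm.trans ?_
  refine Eq.trans ?_ (comp_mul (.single (idCell _)) (.single (unitCell D)) (homCell j e)
    (mapCell e) hj he he).symm
  exact (congrArg₂ mul (single_id_comp _ hj he) (mapCell_unit e)).symm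

theorem unit_leftAct (c : D ⟶ C) (g : B ⟶ C) (hD : 𝟙 D ≫ 𝟙 D = 𝟙 D) (hB : 𝟙 B ≫ 𝟙 B = 𝟙 B) :
    compCell (.cons (unitCell D) (.single (idCell (hom c g))) rfl) (leftAct c g) hD hB =
      idCell (hom c g) := by
  have hc := Category.id_comp c
  have hg := Category.id_comp g
  refine (comp_lift _ hc hg _ hD hB hc hg).trans (lift_unique _ _ ?_)
  refine (single_id_comp _ hc hg).trans ?_
  refine (idHom_mul (homCell c g)).symm.trans ?_
  refine Eq.trans ?_ (comp_mul (.single (unitCell D)) (.single (idCell _)) (mapCell c)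
    (homCell c g) hc hg hc).symm
  exact (congrArg₂ mul (mapCell_unit c) (single_id_comp _ hc hg)).symm

/-- Every 2-cell `E(j, e) ⇒ F(s, y)` commutes with the actions of `D(1, 1)` on the right. -/
theorem mul_mapCell {j : A ⟶ E} {e : D ⟶ E} {s : A ⟶ F} {y : D ⟶ F}
    (χ : HomCell s (.single (hom j e)) y) :
    mul χ (mapCell y) =
      compCell (.single (rightAct j e)) χ (Category.id_comp s) (Category.id_comp y) := by
  have hs := Category.id_comp s
  have hy := Category.id_comp y
  have hA : 𝟙 A ≫ 𝟙 A = 𝟙 A := Category.comp_id _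
  have hD : 𝟙 D ≫ 𝟙 D = 𝟙 D := Category.comp_id _
  -- Both sides become χ when the unit of D is inserted on the right, and the unit is opcartesian.
  refine (unitCell_opcartesian D (.single (hom j e)) (.nil D) s (unit F) y χ).unique ?_ ?_
  · refine (comp_mul (.single (idCell _)) (.single (unitCell D)) χ (mapCell y) hs hy hy).trans ?_
    refine (congrArg₂ mul (single_id_comp χ hs hy) (mapCell_unit y)).trans ?_
    exact mul_idHom χ (Category.comp_id _) (Category.comp_id _)
  · refine (comp_assoc' _ (.single (rightAct j e)) _ χ
      (isComp_single (unit_rightAct j e hA hD)) hA hD hs hy hs hy hs hy).trans ?_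
    exact single_id_comp χ hs hy

/-- Naturality of χ in its right-hand object, a consequence of `mul_mapCell`: transporting along ε
before or after χ gives the same result. -/
theorem comp_lift_mul_map {j : A ⟶ E} {e : D ⟶ E} {s : A ⟶ F} {y : D ⟶ F}
    (χ : HomCell s (.single (hom j e)) y) {qs : Chain A B} {ps : Chain B C} {d : B ⟶ D} {d' : C ⟶ D}
    {x : B ⟶ E} {x' : C ⟶ E} {z : B ⟶ F} {z' : C ⟶ F} (β : HomCell j qs x) (ε : HomCell d ps d')
    (hx : d ≫ e = x) (hx' : d' ≫ e = x') (hz : d ≫ y = z) (hz' : d' ≫ y = z') :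
    compCell (.single (lift (mul β (map ε e hx hx')) (Category.id_comp j) hx')) χ
        (Category.id_comp s) hz' =
      mul (compCell (.single (lift β (Category.id_comp j) hx)) χ (Category.id_comp s) hz)
        (map ε y hz hz') := by
  have hA : 𝟙 A ≫ 𝟙 A = 𝟙 A := Category.comp_id _
  have hs := Category.id_comp s
  have hj := Category.id_comp j
  refine Eq.trans ?_ (comp_mul (.single (lift β hj hx)) (.single ε) χ (mapCell y) hs hz' hz)
  refine Eq.trans ?_ (congrArg (fun z => compCell _ z hs hz') (mul_mapCell χ).symm)
  refine (comp_assoc' _ (.single (rightAct j e)) _ χ (isComp_single (hk := hA)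
    (hl := Category.comp_id d') ?_) hA (Category.comp_id d')
    hs (Category.id_comp y) hs hz' hs hz').symm
  refine (comp_lift _ hj (Category.id_comp e) _ hA (Category.comp_id d') hj hx').trans ?_
  refine congrArg (fun z => lift z hj hx') ?_
  refine (comp_mul (.single (lift β hj hx)) (.single ε) (homCell j e) (mapCell e) hj hx'
    hx).trans ?_
  exact congrArg (fun z => mul z _) (lift_comp β hj hx)

end

/-! ### Colimits, density and j-absoluteness -/

section
variable {X : Type u} [VirtualEquipment.{t, w, v, u} X] {A B C D E Y Z : X}

theorem Cells.heq_cons {A B C A' B' C' : X} {f : A ⟶ A'} {g : B ⟶ B'} {h : C ⟶ C'}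
    {ps : Chain A B} {ps₁ ps₂ : Chain B C} {ps₁' ps₂' : Chain A C} {q : Loose A' B'}
    {qs : Chain B' C'} (φ : Cell f ps q g) {Φ₁ : Cells g ps₁ qs h} {Φ₂ : Cells g ps₂ qs h}
    (e₁ : ps.append ps₁ = ps₁') (e₂ : ps.append ps₂ = ps₂') (e : ps₁ = ps₂) (i : HEq Φ₁ Φ₂) :
    HEq (Cells.cons φ Φ₁ e₁) (Cells.cons φ Φ₂ e₂) := by
  subst e e₁ e₂
  cases i
  rfl

/-- The list of identity 2-cells on a chain, followed by the 2-cell `id ⇒ E(x, 1)` on `x`. -/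
noncomputable def idSnoc (x : B ⟶ E) : {Y : X} → (qs : Chain Y B) →
    Cells (𝟙 Y) qs (qs.append (.single (hom x (𝟙 E)))) x
  | _, .nil _ => .single (lift (idHom x) (Category.id_comp x) (Category.comp_id x))
  | _, .cons p qs => .cons (idCell p) (idSnoc x qs) rfl

/-- Appending to a list of identities produces the source `qs.append nil`, which equals `qs` only
propositionally. The recursive `idSnoc` has source `qs` itself, and this comparison carries
composites of appended lists over to it. -/
theorem idSnoc_heq (x : B ⟶ E) (qs : Chain Y B) :
    HEq ((Cells.id qs).append
      (.single (lift (idHom x) (Category.id_comp x) (Category.comp_id x)))) (idSnoc x qs) := by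
  induction qs with
  | nil => rfl
  | cons p qs ih => exact Cells.heq_cons _ _ _ qs.append_nil (ih x)

theorem idSnoc_comp_mul {c : Y ⟶ E} {x : B ⟶ E} {qs : Chain Y B} (β : HomCell c qs x)
    (hc : 𝟙 Y ≫ c = c) (hx : x ≫ 𝟙 E = x) :
    compCell (idSnoc x qs) (mul β (homCell x (𝟙 E))) hc hx = β := by
  have hcE := Category.comp_id c
  have hE : 𝟙 E ≫ 𝟙 E = 𝟙 E := Category.comp_id _
  -- The source chain is generalized to `ts` so that the equation of chains and the heterogeneous
  -- equality can both be eliminated.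
  have key : ∀ {ts : Chain Y B} (e : qs.append (.nil B) = ts)
      (Φ : Cells (𝟙 Y) ts (qs.append (.single (hom x (𝟙 E)))) x),
      HEq ((Cells.id qs).append
        (.single (lift (idHom x) (Category.id_comp x) (Category.comp_id x)))) Φ →
      Cells.IsComp Φ (Cells.cons β (.single (homCell x (𝟙 E))) rfl)
        (.cons β (.single (idHom x)) e) := by
    intro ts e Φ h
    subst e
    cases h
    exact isComp_cons (hk := hc) (hl := Category.id_comp x) (Cells.id qs) (id_comp' β _ _)
      (isComp_single (hk := Category.id_comp x) (hl := hx) (lift_comp _ _ _))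
  refine (comp_assoc' _ _ _ _ (key qs.append_nil _ (idSnoc_heq x qs)) hc hx hcE hE hc hx hcE
    hx).trans ?_
  exact mul_idHom β hcE hx

/-- A Yoneda argument extends the universal property from targets E(c, 1) to targets E(c, x): append
E(x, 1) to the source, use the given bijection, then restrict back along the identity of x. -/
theorem IsColimit.bijective {p : Loose Z Y} {f : Z ⟶ E} {c : Y ⟶ E} {γ : HomCell f (.single p) c}
    (h : IsColimit γ) (qs : Chain Y B) (x : B ⟶ E) :
    Function.Bijective (fun β : HomCell c qs x => (mul γ β : HomCell f (.cons p qs) x)) := by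
  have hf := Category.id_comp f
  have hc := Category.id_comp c
  have hx := Category.comp_id x
  have assoc : ∀ β : HomCell c qs x, mul γ (mul β (homCell x (𝟙 E))) =
      mul (mul γ β : HomCell f (.cons p qs) x) (homCell x (𝟙 E)) := fun β =>
    (mul_assoc γ β (homCell x (𝟙 E)) rfl rfl (Category.comp_id f) (Category.comp_id _)).symm
  constructor
  · intro β₁ β₂ e
    have e' : mul γ (mul β₁ (homCell x (𝟙 E))) = mul γ (mul β₂ (homCell x (𝟙 E))) :=
      (assoc β₁).trans ((congrArg
        (fun z : HomCell f (.cons p qs) x => mul (ps := .cons p qs)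
          (qs := .single (hom x (𝟙 E))) z (homCell x (𝟙 E))) e).trans (assoc β₂).symm)
    exact (idSnoc_comp_mul β₁ hc hx).symm.trans ((congrArg (fun z => compCell (idSnoc x qs) z hc hx)
      ((h _).1 e')).trans (idSnoc_comp_mul β₂ hc hx))
  · intro ξ
    obtain ⟨ω, hω⟩ := (h (qs.append (.single (hom x (𝟙 E))))).2
      (mul (ps := .cons p qs) ξ (homCell x (𝟙 E)))
    refine ⟨compCell (idSnoc x qs) ω hc hx, ?_⟩
    refine Eq.trans ?_ (idSnoc_comp_mul ξ hf hx)
    refine Eq.trans ?_ (congrArg (fun z => compCell (idSnoc x (.cons p qs)) z hf hx) hω)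
    refine Eq.symm ?_
    refine (comp_mul (.single (idCell p)) (idSnoc x qs) γ ω hf hx hc).trans ?_
    exact congrArg (fun z => mul z (compCell (idSnoc x qs) ω hc hx)) (single_id_comp γ hf hc)

/-- By density every y is the E(j, y)-weighted colimit of j. The test chain `qs` is replaced by E(1,
y), `qs`, to which density applies. The loose-cell E(1, y) is then removed by means of the identity
of y. -/
theorem IsDense.bijective {j : A ⟶ E} (hj : IsDense j) (y : B ⟶ E) (qs : Chain B E) :
    Function.Bijective (fun β : HomCell y qs (𝟙 E) =>
      (mul (homCell j y) β : HomCell j (.cons (hom j y) qs) (𝟙 E))) := by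
  have hE : 𝟙 E ≫ 𝟙 E = 𝟙 E := Category.comp_id _
  have hA : 𝟙 A ≫ 𝟙 A = 𝟙 A := Category.comp_id _
  have hB : 𝟙 B ≫ 𝟙 B = 𝟙 B := Category.comp_id _
  have hj' := Category.id_comp j
  have hy := Category.id_comp y
  have hy' := Category.comp_id y
  let L : Cell y (.nil B) (hom (𝟙 E) y) (𝟙 B) := lift (idHom y) hy' hy
  let μ : Cell (𝟙 A) (.cons (hom j (𝟙 E)) (.single (hom (𝟙 E) y))) (hom j y) (𝟙 B) :=
    lift (mul (homCell j (𝟙 E)) (homCell (𝟙 E) y)) hj' hy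
  let ρ : Cell (𝟙 A) (.single (hom j y)) (hom j (𝟙 E)) y := lift (homCell j y) hj' hy'
  have hL : ∀ β : HomCell y qs (𝟙 E),
      compCell (.cons L (Cells.id qs) rfl) (mul (homCell (𝟙 E) y) β) hy' hE = β := fun β =>
    (comp_mul (.single L) (Cells.id qs) (homCell (𝟙 E) y) β hy' hE hy).trans
      ((congrArg₂ mul (lift_comp (idHom y) hy' hy) (id_comp' β hy hE)).trans (idHom_mul β))
  have hμ : ∀ β : HomCell y qs (𝟙 E), compCell (.cons μ (Cells.id qs) rfl)
      (mul (homCell j y) β) hj' hE = mul (homCell j (𝟙 E)) (mul (homCell (𝟙 E) y) β) := fun β =>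
    (comp_mul (.single μ) (Cells.id qs) (homCell j y) β hj' hE hy).trans
      ((congrArg₂ mul (lift_comp _ hj' hy) (id_comp' β hy hE)).trans
        (mul_assoc (homCell j (𝟙 E)) (homCell (𝟙 E) y) β rfl rfl (Category.comp_id _) hE))
  constructor
  · intro β₁ β₂ e
    have e' : mul (homCell j (𝟙 E)) (mul (homCell (𝟙 E) y) β₁) =
        mul (homCell j (𝟙 E)) (mul (homCell (𝟙 E) y) β₂) :=
      (hμ β₁).symm.trans ((congrArg (fun z => compCell (.cons μ (Cells.id qs) rfl) z hj' hE)
        e).trans (hμ β₂))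
    exact (hL β₁).symm.trans ((congrArg (fun z => compCell (.cons L (Cells.id qs) rfl) z hy' hE)
      ((hj (.cons (hom (𝟙 E) y) qs)).1 e')).trans (hL β₂))
  · intro ξ
    obtain ⟨ω, hω⟩ := (hj (.cons (hom (𝟙 E) y) qs)).2
      (compCell (.cons μ (Cells.id qs) rfl) ξ hj' hE)
    refine ⟨compCell (.cons L (Cells.id qs) rfl) ω hy' hE, ?_⟩
    -- The composition μ is split by ρ and L, so restricting the factorization of ξ pasted with μ
    -- returns ξ itself.
    have e₁ : compCell (.cons ρ (.single L) rfl) μ hA hB = idCell (hom j y) := by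
      refine (comp_lift _ hj' hy _ hA hB hj' hy).trans (lift_unique _ _ ?_)
      refine (single_id_comp _ hj' hy).trans ?_
      refine Eq.trans ?_ (comp_mul (.single ρ) (.single L) (homCell j (𝟙 E)) (homCell (𝟙 E) y)
        hj' hy hy').symm
      refine Eq.trans ?_ (congrArg₂ mul (lift_comp (homCell j y) hj' hy').symm
        (lift_comp (idHom y) hy' hy).symm)
      exact (mul_idHom (homCell j y) (Category.comp_id _) hy').symm
    refine Eq.trans ?_ (id_comp' ξ hj' hE)
    refine Eq.trans ?_ (comp_assoc' (.cons ρ (.cons L (Cells.id qs) rfl) rfl)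
      (.cons μ (Cells.id qs) rfl) (Cells.id (.cons (hom j y) qs)) ξ
      (isComp_cons (.cons ρ (.single L) rfl) e₁ (Cells.isComp_id qs)) hA hE hj' hE hj' hE hj' hE)
    refine Eq.trans ?_ (congrArg (fun z => compCell (.cons ρ (.cons L (Cells.id qs) rfl) rfl) z hj'
      hE) hω)
    refine Eq.trans ?_ (comp_mul (.single ρ) (.cons L (Cells.id qs) rfl) (homCell j (𝟙 E)) ω
      hj' hE hy').symm
    exact congrArg (fun z => mul z (compCell (.cons L (Cells.id qs) rfl) ω hy' hE))
      (lift_comp (homCell j y) hj' hy').symm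

theorem absoluteCell_comp (j : A ⟶ E) {p : Loose Z Y} {f : Z ⟶ E} {c : Y ⟶ E}
    (γ : HomCell f (.single p) c) (hj : 𝟙 A ≫ j = j) (hc : 𝟙 Y ≫ c = c) :
    compCell (.single (absoluteCell j γ)) (homCell j c) hj hc = mul (homCell j f) γ :=
  lift_comp _ _ _

theorem absoluteCell_comp_mul (j : A ⟶ E) {p : Loose Z Y} {f : Z ⟶ E} {c : Y ⟶ E}
    (γ : HomCell f (.single p) c) {qs : Chain Y B} {x : B ⟶ E} (β : HomCell c qs x)
    (hj : 𝟙 A ≫ j = j) (hx : 𝟙 B ≫ x = x) :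
    compCell (.cons (absoluteCell j γ) (Cells.id qs) rfl) (mul (homCell j c) β) hj hx =
      mul (homCell j f) (mul γ β) :=
  (comp_mul (.single (absoluteCell j γ)) (Cells.id qs) (homCell j c) β hj hx
    (Category.id_comp c)).trans
    ((congrArg₂ mul (absoluteCell_comp j γ _ _) (id_comp' β _ _)).trans
      (mul_assoc (homCell j f) γ β rfl rfl (Category.comp_id _) (Category.comp_id _)))

/-- Left-opcartesian 2-cells are stable under composition with an invertible 2-cell, so the choice
of left-composite is immaterial and j-absoluteness becomes a property of the canonical 2-cell alone.
-/
theorem IsAbsolute.isLeftOpcartesian {j : A ⟶ E} {p : Loose Z Y} {f : Z ⟶ E} {c : Y ⟶ E}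
    {γ : HomCell f (.single p) c} (h : IsAbsolute j γ) :
    IsLeftOpcartesian (absoluteCell j γ) := by
  obtain ⟨q, κ, θ, hκ, e, θ', h₁, h₂⟩ := h
  have hA : 𝟙 A ≫ 𝟙 A = 𝟙 A := Category.comp_id _
  have hY : 𝟙 Y ≫ 𝟙 Y = 𝟙 Y := Category.comp_id _
  intro B₀ A' B' rs f s g x
  have hf := Category.id_comp f
  have hg := Category.id_comp g
  have hB := Category.id_comp (𝟙 B₀)
  have cancel : ∀ (y : Cell f (.cons (hom j c) rs) s g),
      compCell (.cons κ (Cells.id rs) rfl) (compCell (.cons θ (Cells.id rs) rfl) y hf hg) hf hg =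
        compCell (.cons (absoluteCell j γ) (Cells.id rs) rfl) y hf hg := fun y =>
    comp_assoc' _ _ _ _ (isComp_cons (.single κ) e (Cells.isComp_id rs)) hA hB hf hg hf hg hf hg
  obtain ⟨y, hy, hy'⟩ := hκ rs f s g x
  refine ⟨compCell (.cons θ' (Cells.id rs) rfl) y hf hg, ?_, ?_⟩
  · refine (cancel _).symm.trans (Eq.trans ?_ hy)
    refine congrArg (fun z => compCell (.cons κ (Cells.id rs) rfl) z hf hg) ?_
    refine (comp_assoc' _ _ _ _ (isComp_cons (.single θ) h₁ (Cells.isComp_id rs)) hA hB hf hg hf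
      hg hf hg).trans ?_
    exact id_comp' (ps := .cons q rs) y hf hg
  · intro z hz
    refine Eq.trans ?_ (congrArg (fun z => compCell (.cons θ' (Cells.id rs) rfl) z hf hg)
      (hy' _ ((cancel z).trans hz)))
    refine ((comp_assoc' _ _ _ _ (isComp_cons (.single θ') h₂ (Cells.isComp_id rs)) hA hB hf hg hf
      hg hf hg).trans ?_).symm
    exact id_comp' (ps := .cons (hom j c) rs) z hf hg

theorem isAbsolute_of_isLeftOpcartesian {j : A ⟶ E} {p : Loose Z Y} {f : Z ⟶ E} {c : Y ⟶ E}
    {γ : HomCell f (.single p) c} (h : IsLeftOpcartesian (absoluteCell j γ)) : IsAbsolute j γ :=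
  ⟨_, absoluteCell j γ, idCell _, h, compCell_id _, idCell _, compCell_id _, compCell_id _⟩

/-- For a dense tight-cell `j`, a cocone is a colimit as soon as the canonical 2-cell
`E(j, f), p ⇒ E(j, c)` is left-opcartesian. -/
theorem IsDense.isColimit {j : A ⟶ E} (hj : IsDense j) {p : Loose Z Y} {f : Z ⟶ E} {c : Y ⟶ E}
    {γ : HomCell f (.single p) c} (h : IsLeftOpcartesian (absoluteCell j γ)) : IsColimit γ := by
  intro qs
  have hj' := Category.id_comp j
  have hE := Category.id_comp (𝟙 E)
  -- Pasting with γ is one side of a commuting square (`absoluteCell_comp_mul`). Its other sides are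
  -- bijections: pasting with E(j, c) and with E(j, f), by density at c and f, and factoring through
  -- the canonical 2-cell.
  have inj := h qs j (unit E) (𝟙 E)
  constructor
  · intro β₁ β₂ e
    refine (hj.bijective c qs).1 ((inj _).unique (absoluteCell_comp_mul j γ β₁ hj' hE) ?_)
    exact (absoluteCell_comp_mul j γ β₂ hj' hE).trans (congrArg (mul (homCell j f)) e.symm)
  · intro ξ
    obtain ⟨ω, hω, -⟩ := inj (mul (qs := .cons p qs) (homCell j f) ξ)
    obtain ⟨β, rfl⟩ := (hj.bijective c qs).2 ω
    refine ⟨β, (hj.bijective f (.cons p qs)).1 ?_⟩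
    exact (absoluteCell_comp_mul j γ β hj' hE).symm.trans hω

end

/-! ### Left-composites of E(j, r), C(c, 1) for a right j-adjoint r -/

namespace RelativeAdjunction
variable {X : Type u} [VirtualEquipment.{t, w, v, u} X] {A B C D E : X}
variable {j : A ⟶ E} {r : D ⟶ E} (adj : RelativeAdjunction j r)

/-- The unit, as a 2-cell into `E(j, r)`. -/
noncomputable def unitLift : Cell (𝟙 A) (.nil A) (hom j r) adj.left :=
  lift adj.unit (Category.id_comp j) rfl

/-- The 2-cell `E(j, r), C(c, 1) ⇒ C(left ≫ c, 1)`, the canonical composite. -/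
noncomputable def compositor (c : D ⟶ C) {m : A ⟶ C} (hm : adj.left ≫ c = m) :
    HomCell m (.cons (hom j r) (.single (hom c (𝟙 C)))) (𝟙 C) :=
  mul (map adj.untranspose c hm (Category.id_comp c)) (homCell c (𝟙 C))

/-- The 2-cell `E(j, r), C(c, 1) ⇒ C(c, 1)` with `left` on its left-hand side. -/
noncomputable def compositorLift (c : D ⟶ C) :
    Cell adj.left (.cons (hom j r) (.single (hom c (𝟙 C)))) (hom c (𝟙 C)) (𝟙 C) :=
  lift (adj.compositor c rfl) rfl (Category.id_comp _)

/-- Apply the untransposition to E(j, r) to get a loose-identity D(1, 1) and insert the unit before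
it. Letting D(1, 1) act to the right on C(c, 1) gives the compositor; letting it act to the left on
E(j, r) gives the identity, by a triangle law. The two agree because every 2-cell is balanced over
D. -/
theorem unitLift_compositorLift (c : D ⟶ C) {A' B₀ B' : X} {rs : Chain C B₀} {f : A ⟶ A'}
    {s : Loose A' B'} {g : B₀ ⟶ B'}
    (x : Cell f (.cons (hom j r) (.cons (hom c (𝟙 C)) rs)) s g) (hf : 𝟙 A ≫ f = f)
    (hg : 𝟙 B₀ ≫ g = g) :
    compCell (.cons adj.unitLift (.cons (adj.compositorLift c) (Cells.id rs) rfl) rfl) x hf hg =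
      x := by
  have hA : 𝟙 A ≫ 𝟙 A = 𝟙 A := Category.comp_id _
  have hD : 𝟙 D ≫ 𝟙 D = 𝟙 D := Category.comp_id _
  have hC : 𝟙 C ≫ 𝟙 C = 𝟙 C := Category.comp_id _
  have hB : 𝟙 B₀ ≫ 𝟙 B₀ = 𝟙 B₀ := Category.comp_id _
  have hj := Category.id_comp j
  have hr := Category.id_comp r
  have hc := Category.id_comp c
  have hl := Category.comp_id adj.left
  -- Balancedness over D: both sides reduce to x when the unit of D is inserted between E(j, r) and
  -- C(c, 1).
  have e₁ : compCell (.cons (idCell (hom j r)) (.cons (leftAct c (𝟙 C)) (Cells.id rs) rfl) rfl) x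
      hf hg = compCell (.cons (rightAct j r) (.cons (idCell (hom c (𝟙 C))) (Cells.id rs) rfl) rfl) x
      hf hg := by
    refine (unitCell_opcartesian D (.single (hom j r)) (.cons (hom c (𝟙 C)) rs) f s g x).unique
      ?_ ?_
    · refine (comp_assoc' _ _ (Cells.id (.cons (hom j r) (.cons (hom c (𝟙 C)) rs))) x
        (isComp_cons (.single (idCell _)) (compCell_id _)
          (isComp_cons (.cons (unitCell D) (.single (idCell _)) rfl)
            (unit_leftAct c (𝟙 C) hD hC) (Cells.isComp_id rs))) hA hB hf hg hf hg hf hg).trans ?_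
      exact id_comp' x hf hg
    · refine (comp_assoc' _ _ (Cells.id (.cons (hom j r) (.cons (hom c (𝟙 C)) rs))) x
        (isComp_cons (.cons (idCell _) (.single (unitCell D)) rfl)
          (unit_rightAct j r hA hD) (Cells.isComp_id (.cons (hom c (𝟙 C)) rs)))
          hA hB hf hg hf hg hf hg).trans ?_
      exact id_comp' x hf hg
  have e₂ : compCell (.cons adj.untranspose (.single (idCell (hom c (𝟙 C)))) rfl)
      (leftAct c (𝟙 C)) hl hC = adj.compositorLift c := by
    refine (comp_lift _ hc hC _ hl hC rfl hC).trans ?_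
    refine congrArg (fun z => lift z rfl hC) ?_
    refine (comp_mul (.single adj.untranspose) (.single (idCell _)) (mapCell c) (homCell c (𝟙 C))
      rfl hC hc).trans ?_
    exact congrArg (mul _) (single_id_comp _ hc hC)
  have e₃ : compCell (.cons adj.unitLift (.single adj.untranspose) rfl) (rightAct j r) hA hD =
      idCell (hom j r) := by
    refine (comp_lift _ hj hr _ hA hD hj hr).trans (lift_unique _ _ ?_)
    refine (single_id_comp _ hj hr).trans ?_
    refine Eq.trans ?_ (comp_mul (.single adj.unitLift) (.single adj.untranspose) (homCell j r)
      (mapCell r) hj hr rfl).symm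
    exact adj.unit_act.symm.trans (congrArg (fun z => mul z adj.act) (lift_comp _ hj rfl).symm)
  refine (comp_assoc' (.cons adj.unitLift (.cons adj.untranspose
    (.cons (idCell (hom c (𝟙 C))) (Cells.id rs) rfl) rfl) rfl)
    (.cons (idCell (hom j r)) (.cons (leftAct c (𝟙 C)) (Cells.id rs) rfl) rfl) _ x
    (isComp_cons (.single adj.unitLift) (compCell_id _)
      (isComp_cons (.cons adj.untranspose (.single (idCell _)) rfl) e₂ (Cells.isComp_id rs)))
    hA hB hf hg hf hg hf hg).symm.trans ?_
  refine (congrArg (fun z => compCell _ z hf hg) e₁).trans ?_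
  refine (comp_assoc' _ _ (Cells.id (.cons (hom j r) (.cons (hom c (𝟙 C)) rs))) x
    (isComp_cons (.cons adj.unitLift (.single adj.untranspose) rfl) e₃
      (Cells.isComp_id (.cons (hom c (𝟙 C)) rs))) hA hB hf hg hf hg hf hg).trans ?_
  exact id_comp' x hf hg

/-- The factorization of x is x precomposed with the unit followed by ψ: `h₂` with
`unitLift_compositorLift` makes it a factorization, and `h₁` makes it the only one. -/
theorem isLeftOpcartesian_of_section {c : D ⟶ C} {q : Loose A C}
    {κ : Cell (𝟙 A) (.cons (hom j r) (.single (hom c (𝟙 C)))) q (𝟙 C)}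
    (ψ : Cell adj.left (.single q) (hom c (𝟙 C)) (𝟙 C))
    (h₁ : compCell (.cons adj.unitLift (.single ψ) rfl) κ (Category.comp_id _)
      (Category.comp_id _) = idCell q)
    (h₂ : compCell (.single κ) ψ (Category.id_comp _) (Category.comp_id _) =
      adj.compositorLift c) :
    IsLeftOpcartesian κ := by
  have hA : 𝟙 A ≫ 𝟙 A = 𝟙 A := Category.comp_id _
  intro B₀ A' B' rs f s g x
  have hf := Category.id_comp f
  have hg := Category.id_comp g
  have hB := Category.id_comp (𝟙 B₀)
  have hl := Category.id_comp adj.left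
  refine ⟨compCell (.cons adj.unitLift (.cons ψ (Cells.id rs) rfl) rfl) x hf hg, ?_, ?_⟩
  · refine (comp_assoc' _ _ _ _ (isComp_cons (.nil rfl) (id_comp' (ps := .nil A) _ hA hl)
      (isComp_cons (.single κ) h₂ (Cells.isComp_id rs))) hA hB hf hg hf hg hf hg).trans ?_
    exact adj.unitLift_compositorLift c x hf hg
  · rintro y rfl
    refine ((comp_assoc' _ _ (Cells.id (.cons q rs)) y
      (isComp_cons (.cons adj.unitLift (.single ψ) rfl) h₁ (Cells.isComp_id rs))
      hA hB hf hg hf hg hf hg).trans ?_).symm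
    exact id_comp' y hf hg

/-- Factoring the compositor through κ yields ψ. The unit and ψ, followed by κ, give an endomorphism
of q that fixes κ, hence the identity. So κ has a section at the level of chains, which survives
placing further loose-cells on its left. -/
theorem exists_section {c : D ⟶ C} {q : Loose A C}
    {κ : Cell (𝟙 A) (.cons (hom j r) (.single (hom c (𝟙 C)))) q (𝟙 C)} (hκ : IsLeftOpcartesian κ) :
    ∃ ψ : Cell adj.left (.single q) (hom c (𝟙 C)) (𝟙 C),
      compCell (.cons adj.unitLift (.single ψ) rfl) κ (Category.comp_id _) (Category.comp_id _) =
        idCell q := by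
  have hA : 𝟙 A ≫ 𝟙 A = 𝟙 A := Category.comp_id _
  have hC : 𝟙 C ≫ 𝟙 C = 𝟙 C := Category.comp_id _
  have hl := Category.id_comp adj.left
  obtain ⟨ψ, hψ, -⟩ := hκ (.nil C) adj.left (hom c (𝟙 C)) (𝟙 C) (adj.compositorLift c)
  refine ⟨ψ, (hκ (.nil C) (𝟙 A) q (𝟙 C) κ).unique ?_ (compCell_id κ)⟩
  refine (comp_assoc' _ _ _ _ (isComp_cons (.nil rfl) (id_comp' (ps := .nil A) _ hA hl)
      (isComp_single hψ)) hA hC hA hC hA hC hA hC).trans ?_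
  exact adj.unitLift_compositorLift c κ hA hC

end RelativeAdjunction

/-! ### Operators, graded morphisms and algebra objects -/

section
variable {X : Type u} [VirtualEquipment.{t, w, v, u} X] {A B C D E Y Z : X}

theorem extend_mul_map {j s : A ⟶ E} {e : D ⟶ E} (a : HomCell s (.single (hom j e)) e)
    {qs : Chain A B} {ps : Chain B C} {d : B ⟶ D} {d' : C ⟶ D} {x : B ⟶ E} {x' : C ⟶ E}
    (β : HomCell j qs x) (ε : HomCell d ps d') (hx : d ≫ e = x) (hx' : d' ≫ e = x') :
    extend a (mul β (map ε e hx hx')) d' hx' = mul (extend a β d hx) (map ε e hx hx') :=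
  comp_lift_mul_map a β ε hx hx' hx hx'

/-- If the operator a' on c is induced by the operator a on f through the canonical 2-cell, then
extending by a' commutes with pasting by γ. -/
theorem extend_mul_cocone {j s : A ⟶ E} {f : Z ⟶ E} {c : Y ⟶ E} {p : Loose Z Y}
    {γ : HomCell f (.single p) c} {a : HomCell s (.single (hom j f)) f}
    {a' : HomCell s (.single (hom j c)) c} {hs : 𝟙 A ≫ s = s} {hc : 𝟙 Y ≫ c = c}
    (h : compCell (.single (absoluteCell j γ)) a' hs hc = mul a γ)
    {ps : Chain A Z} (β : HomCell j ps f) (hf : 𝟙 Z ≫ f = f) :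
    extend a' (mul β γ) (𝟙 Y) hc = mul (extend a β (𝟙 Z) hf) γ := by
  have hA : 𝟙 A ≫ 𝟙 A = 𝟙 A := Category.comp_id _
  have hY : 𝟙 Y ≫ 𝟙 Y = 𝟙 Y := Category.comp_id _
  have hj := Category.id_comp j
  have e : compCell (.cons (lift β hj hf) (.single (idCell p)) rfl) (absoluteCell j γ) hA hY =
      lift (mul β γ) hj hc := by
    refine (comp_lift _ hj hc _ hA hY hj hc).trans (congrArg (fun z => lift z hj hc) ?_)
    refine (comp_mul (.single (lift β hj hf)) (.single (idCell p)) (homCell j f) γ hj hc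
      hf).trans ?_
    exact congrArg₂ mul (lift_comp β hj hf) (single_id_comp γ hf hc)
  refine (comp_assoc' _ _ _ _ (isComp_single e) hA hY hs hc hs hc hs hc).symm.trans ?_
  refine (congrArg (fun z => compCell (.cons (lift β hj hf) (.single (idCell p)) rfl) z hs hc)
    h).trans ?_
  refine (comp_mul (.single (lift β hj hf)) (.single (idCell p)) a γ hs hc hf).trans ?_
  exact congrArg (mul _) (single_id_comp γ hf hc)

namespace RelativeMonad
variable {j : A ⟶ E} {T : RelativeMonad j}

/-- The free algebra on the root. -/
noncomputable def freeAlgebra (T : RelativeMonad j) : T.Algebra A where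
  carrier := T.carrier
  act := T.ext
  unit_act := T.unit_ext
  ext_act := T.ext_ext

namespace Algebra

theorem Factors.refl (a : T.Algebra C) : a.Factors a (𝟙 C) :=
  ⟨Category.id_comp _, extend_homCell _ _⟩

theorem Factors.comp {a : T.Algebra C} {b : T.Algebra D} {x : T.Algebra B} {c : D ⟶ C} {d : B ⟶ D}
    (h : a.Factors b c) (h' : b.Factors x d) : a.Factors x (d ≫ c) := by
  refine ⟨by rw [Category.assoc, h.comp_carrier, h'.comp_carrier], ?_⟩
  refine (extend_extend a.act c h.comp_carrier (homCell j x.carrier) d h'.comp_carrier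
    rfl).symm.trans ?_
  exact (congrArg (fun z => extend z _ d h'.comp_carrier) h.extend_act).trans h'.extend_act

/-- The operators of b and b' are restrictions of that of a, so the graded morphism law is
naturality of the operator of a. Hence uniqueness in an algebra object applies to every 2-cell of
the form `map ε a.carrier`. -/
theorem isMorphism_map {a : T.Algebra C} {b : T.Algebra B} {b' : T.Algebra D} {c : B ⟶ C}
    {c' : D ⟶ C} (h : a.Factors b c) (h' : a.Factors b' c') {ps : Chain B D} (ε : HomCell c ps c') :
    b.IsMorphism b' (map ε a.carrier h.comp_carrier h'.comp_carrier) := by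
  refine (congrArg (fun z => extend z (mul (homCell j b.carrier)
    (map ε a.carrier h.comp_carrier h'.comp_carrier)) (𝟙 D) (Category.id_comp _))
    h'.extend_act).symm.trans ?_
  refine (extend_extend a.act c' h'.comp_carrier _ (𝟙 D) _ (Category.id_comp c')).trans ?_
  refine (extend_mul_map a.act (homCell j b.carrier) ε h.comp_carrier h'.comp_carrier).trans ?_
  exact congrArg (fun z => mul z _) h.extend_act

theorem IsAlgebraObject.map_injective {a : T.Algebra C} (ha : a.IsAlgebraObject) {b : T.Algebra B}
    {b' : T.Algebra D} {c : B ⟶ C} {c' : D ⟶ C} (h : a.Factors b c) (h' : a.Factors b' c')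
    {ps : Chain B D} {ε₁ ε₂ : HomCell c ps c'}
    (e : map ε₁ a.carrier h.comp_carrier h'.comp_carrier =
      map ε₂ a.carrier h.comp_carrier h'.comp_carrier) : ε₁ = ε₂ :=
  (ha.existsUnique_cell h h' ps _ (isMorphism_map h h' ε₂)).unique e rfl

theorem IsAlgebraObject.of_isIso {a : T.Algebra C} (ha : a.IsAlgebraObject) {b : T.Algebra D}
    {i : D ⟶ C} (hi : a.Factors b i) [IsIso i] : b.IsAlgebraObject := by
  have hb : b.Factors a (inv i) := by
    have hc : inv i ≫ b.carrier = a.carrier := by rw [← hi.comp_carrier, IsIso.inv_hom_id_assoc]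
    refine ⟨hc, ?_⟩
    refine (congrArg (fun z => extend z (homCell j a.carrier) (inv i) hc)
      hi.extend_act).symm.trans ?_
    refine (extend_extend a.act i hi.comp_carrier _ (inv i) hc (IsIso.inv_hom_id i)).trans ?_
    exact extend_homCell _ _
  refine ⟨fun x => ?_, fun {B B' x x' d d'} h h' ps ε hε => ?_⟩
  · obtain ⟨c, hc, hu⟩ := ha.existsUnique_tight x
    refine ⟨c ≫ inv i, hb.comp hc, fun d hd => ?_⟩
    rw [← hu _ (hi.comp hd), Category.assoc, IsIso.hom_inv_id, Category.comp_id]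
  · obtain ⟨ε', h₁, h₂⟩ := ha.existsUnique_cell (hi.comp h) (hi.comp h') ps ε hε
    have hd : (d ≫ i) ≫ inv i = d := by rw [Category.assoc, IsIso.hom_inv_id, Category.comp_id]
    have hd' : (d' ≫ i) ≫ inv i = d' := by rw [Category.assoc, IsIso.hom_inv_id, Category.comp_id]
    refine ⟨map ε' (inv i) hd hd', ?_, fun θ hθ => ?_⟩
    · exact (map_map ε' (inv i) b.carrier hb.comp_carrier hd hd' _ _).trans h₁
    · have e := h₂ (map θ i rfl rfl)
        ((map_map θ i a.carrier hi.comp_carrier rfl rfl _ _).trans hθ)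
      refine Eq.trans ?_ (congrArg (fun z => map z (inv i) hd hd') e)
      refine Eq.symm ((map_map θ i (inv i) (IsIso.hom_inv_id i) rfl rfl hd hd').trans ?_)
      exact map_id θ _ _

end Algebra
end RelativeMonad

/-! ### j-absolute extensions of r: algebra structure and creation -/

namespace RelativeAdjunction
variable {j : A ⟶ E} {r : D ⟶ E} (adj : RelativeAdjunction j r)

section
variable {c : D ⟶ C} {r' : C ⟶ E} {γ : HomCell r (.single (hom c (𝟙 C))) r'}
  (h : IsLeftOpcartesian (absoluteCell j γ))

/-- The operator on a `j`-absolute extension `r'` of `r` induced by the operator on `r`. -/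
noncomputable def extensionAct : HomCell (adj.left ≫ r) (.single (hom j r')) r' :=
  (h (.nil C) (adj.left ≫ r) (VirtualEquipment.unit E) r'
    (mul (qs := .single (hom c (𝟙 C))) adj.act γ)).choose

theorem absoluteCell_extensionAct (h₁ h₂) :
    compCell (.single (absoluteCell j γ)) (adj.extensionAct h) h₁ h₂ = mul adj.act γ :=
  (h (.nil C) (adj.left ≫ r) (VirtualEquipment.unit E) r'
    (mul (qs := .single (hom c (𝟙 C))) adj.act γ)).choose_spec.1

theorem unit_extensionAct : mul adj.unit (adj.extensionAct h) = homCell j r' := by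
  have hj := Category.id_comp j
  have hr := Category.id_comp r'
  refine (h (.nil C) j (VirtualEquipment.unit E) r'
    (mul (qs := .single (hom c (𝟙 C))) (homCell j r) γ)).unique ?_ (absoluteCell_comp j γ hj hr)
  refine (comp_unit_mul _ (.single (absoluteCell j γ)) hr).trans ?_
  refine (congrArg (mul adj.unit) (adj.absoluteCell_extensionAct h _ _)).trans ?_
  refine (mul_assoc adj.unit adj.act γ rfl rfl (Category.comp_id _) (Category.comp_id _)).symm.trans
    ?_
  exact congrArg (fun z => mul z γ) adj.unit_act

/-- The associativity law has E(j, t) to the left of E(j, r'), where left-opcartesianness of the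
canonical 2-cell says nothing. The section does: it cancels the canonical 2-cell in that position
too. -/
theorem hom_ext_of_section (adj : RelativeAdjunction j r)
    (h : IsLeftOpcartesian (absoluteCell j γ)) {B A' B' : X} {q : Loose B A}
    {f : B ⟶ A'} {s : Loose A' B'} {g : C ⟶ B'}
    {hf : 𝟙 B ≫ f = f} {hg : 𝟙 C ≫ g = g} {x y : Cell f (.cons q (.single (hom j r'))) s g}
    (e : compCell (.cons (idCell q) (.single (absoluteCell j γ)) rfl) x hf hg =
      compCell (.cons (idCell q) (.single (absoluteCell j γ)) rfl) y hf hg) : x = y := by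
  obtain ⟨ψ, hψ⟩ := adj.exists_section h
  have hB : 𝟙 B ≫ 𝟙 B = 𝟙 B := Category.comp_id _
  have hC : 𝟙 C ≫ 𝟙 C = 𝟙 C := Category.comp_id _
  have key : ∀ z : Cell f (.cons q (.single (hom j r'))) s g,
      compCell (.cons (idCell q) (.cons adj.unitLift (.single ψ) rfl) rfl)
        (compCell (.cons (idCell q) (.single (absoluteCell j γ)) rfl) z hf hg) hf hg = z := fun z =>
    (comp_assoc' _ _ (Cells.id (.cons q (.single (hom j r')))) z
      (isComp_cons (.single (idCell q)) (compCell_id _) (isComp_single hψ))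
      hB hC hf hg hf hg hf hg).trans (id_comp' z hf hg)
  exact (key x).symm.trans ((congrArg (fun z => compCell _ z hf hg) e).trans (key y))

theorem extensionAct_assoc : extend (adj.extensionAct h)
    (mul (homCell j (adj.left ≫ r)) (adj.extensionAct h)) (𝟙 C) (Category.id_comp r') =
      mul adj.ext (adj.extensionAct h) := by
  have hA : 𝟙 A ≫ 𝟙 A = 𝟙 A := Category.comp_id _
  have hC : 𝟙 C ≫ 𝟙 C = 𝟙 C := Category.comp_id _
  have hj := Category.id_comp j
  have hr := Category.id_comp r
  have hr' := Category.id_comp r'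
  have hl := Category.id_comp (adj.left ≫ r)
  have hα := adj.absoluteCell_extensionAct h hl hr'
  have key : ∀ {f : A ⟶ E} (hf : 𝟙 A ≫ f = f)
      (β : HomCell f (.single (hom j (adj.left ≫ r))) (adj.left ≫ r)),
      compCell (.cons (idCell (hom j (adj.left ≫ r))) (.single (absoluteCell j γ)) rfl)
        (mul β (adj.extensionAct h)) hf hr' = mul (mul β adj.act) γ := fun hf β =>
    (comp_mul (.single (idCell _)) (.single (absoluteCell j γ)) β (adj.extensionAct h) hf hr'
      hl).trans ((congrArg₂ mul (single_id_comp β hf hl) hα).trans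
        (mul_assoc β adj.act γ rfl rfl (Category.comp_id _) (Category.comp_id _)).symm)
  -- After precomposition with the canonical 2-cell, both sides become the associativity law of r
  -- pasted with γ.
  refine adj.hom_ext_of_section h (hf := hl) (hg := hr') ?_
  refine Eq.trans ?_ (key hl adj.ext).symm
  refine (comp_extend _ _ (𝟙 C) hr' (.cons (idCell (hom j (adj.left ≫ r)))
    (.single (absoluteCell j γ)) rfl) hr' hC).trans ?_
  refine (congrArg (fun z => extend (adj.extensionAct h) z (𝟙 C) hr') (key hj _)).trans ?_
  refine (extend_mul_cocone hα (mul (homCell j (adj.left ≫ r)) adj.act) hr).trans ?_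
  exact congrArg (fun z => mul z γ) adj.ext_act

/-- The algebra structure on a `j`-absolute extension of the right adjoint. -/
noncomputable def extensionAlgebra : adj.monad.Algebra C where
  carrier := r'
  act := adj.extensionAct h
  unit_act := adj.unit_extensionAct h
  ext_act := adj.extensionAct_assoc h

/-- Both sides of the law for ε, precomposed with the canonical 2-cell, become the sides of the law
for γ pasted with ε, and factorizations through that 2-cell are unique. -/
theorem isMorphism_of_mul_cocone {b : adj.monad.Algebra B} {qs : Chain C B}
    (ε : HomCell r' qs b.carrier)
    (H : adj.algebra.IsMorphism b (ps := .cons (hom c (𝟙 C)) qs) (mul γ ε)) :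
    (adj.extensionAlgebra h).IsMorphism b ε := by
  have hj := Category.id_comp j
  have hr' := Category.id_comp r'
  have hb := Category.id_comp b.carrier
  have hB := Category.id_comp (𝟙 B)
  have hl := Category.id_comp (adj.left ≫ r)
  let Φ : Cells (𝟙 A) (.cons (hom j r) (.cons (hom c (𝟙 C)) qs)) (.cons (hom j r') qs) (𝟙 B) :=
    .cons (absoluteCell j γ) (Cells.id qs) rfl
  have e₁ : compCell Φ (extend b.act (mul (homCell j r') ε) (𝟙 B) hb) hl hb =
      extend b.act (ps := .cons (hom j r) (.cons (hom c (𝟙 C)) qs))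
        (mul (qs := .cons (hom c (𝟙 C)) qs) (homCell j r) (mul γ ε)) (𝟙 B) hb :=
    (comp_extend b.act _ (𝟙 B) hb Φ hb hB).trans
      (congrArg (fun z => extend b.act z (𝟙 B) hb) (absoluteCell_comp_mul j γ ε hj hb))
  have e₂ : compCell Φ (mul (adj.extensionAct h) ε) hl hb =
      mul (qs := .cons (hom c (𝟙 C)) qs) adj.act (mul γ ε) :=
    (comp_mul (.single (absoluteCell j γ)) (Cells.id qs) (adj.extensionAct h) ε hl hb hr').trans
      ((congrArg₂ mul (adj.absoluteCell_extensionAct h hl hr') (id_comp' ε _ _)).trans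
        (mul_assoc adj.act γ ε rfl rfl (Category.comp_id _) (Category.comp_id _)))
  exact (h qs (adj.left ≫ r) (VirtualEquipment.unit E) b.carrier _).unique (e₁.trans H) e₂

theorem isMorphism_cocone : adj.algebra.IsMorphism (adj.extensionAlgebra h) γ := by
  refine (extend_mul_cocone (adj.absoluteCell_extensionAct h (Category.id_comp _) _) (homCell j r)
    (Category.id_comp r)).trans ?_
  exact congrArg (fun z => mul z γ) (extend_homCell _ _)

end

/-- The universal property for algebras lifts r', and the one for graded morphisms lifts the cocone
γ and then the factorizations through it. -/
theorem strictlyCreates_of_isAlgebraObject (ha : adj.algebra.IsAlgebraObject) :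
    StrictlyCreatesAbsoluteExtensions j r := by
  intro C c r' γ hγ habs
  have hj := Category.id_comp j
  have hr := Category.id_comp r
  have hr' := Category.id_comp r'
  have hl := Category.id_comp (adj.left ≫ r)
  have h := habs.isLeftOpcartesian
  have h₀ : adj.algebra.Factors adj.algebra (𝟙 D) := .refl _
  obtain ⟨d, hd, hdu⟩ := ha.existsUnique_tight (adj.extensionAlgebra h)
  obtain ⟨γ', hγ', hu⟩ := ha.existsUnique_cell h₀ hd _ γ (adj.isMorphism_cocone h)
  refine ⟨⟨d, γ'⟩, ⟨hd.comp_carrier, hγ'⟩, ?_, ?_⟩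
  · rintro ⟨d₂, γ₂⟩ ⟨h₂, e₂⟩
    -- Any lift of the cocone induces the same algebra structure on r': its operator and the
    -- extension operator both factor the operator of r pasted with γ through the canonical 2-cell.
    have hd₂ : adj.algebra.Factors (adj.extensionAlgebra h) d₂ := by
      refine ⟨h₂, (h (.nil C) (adj.left ≫ r) (VirtualEquipment.unit E) r'
    (mul (qs := .single (hom c (𝟙 C))) adj.act γ)).unique ?_
        (adj.absoluteCell_extensionAct h hl hr')⟩
      refine (comp_extend adj.act (homCell j r') d₂ h₂ (.single (absoluteCell j γ)) hr'
        (Category.id_comp d₂)).trans ?_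
      refine (congrArg (fun z => extend adj.act z d₂ h₂) (absoluteCell_comp j γ hj hr')).trans ?_
      dsimp only at e₂
      subst e₂
      refine (extend_mul_map adj.act (homCell j r) γ₂ hr h₂).trans ?_
      exact congrArg (fun z => mul z _) (extend_homCell _ _)
    obtain rfl := hdu d₂ hd₂
    rw [hu γ₂ e₂]
  · intro qs
    have map_cocone : ∀ β : HomCell d qs (𝟙 D),
        map (mul γ' β : HomCell (𝟙 D) (.cons (hom c (𝟙 C)) qs) (𝟙 D)) r hr hr =
          mul γ (map β r hd.comp_carrier hr) := fun β =>
      (map_mul γ' β r hr hr hd.comp_carrier).trans (congrArg (fun z => mul z _) hγ')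
    constructor
    · intro β₁ β₂ e
      refine ha.map_injective hd h₀ ((hγ.bijective qs r).1 ?_)
      exact (map_cocone β₁).symm.trans ((congrArg
        (fun z : HomCell (𝟙 D) (.cons (hom c (𝟙 C)) qs) (𝟙 D) => map z r hr hr) e).trans
          (map_cocone β₂))
    · intro ξ
      -- The colimit in E factors the image of ξ. The factor ε is a graded morphism because its
      -- pasting with γ is one, so it lifts to D.
      obtain ⟨ε, hε⟩ := (hγ.bijective qs r).2 (map ξ r hr hr)
      have hm : (adj.extensionAlgebra h).IsMorphism adj.algebra ε := by
        refine adj.isMorphism_of_mul_cocone h (b := adj.algebra) ε ?_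
        have := RelativeMonad.Algebra.isMorphism_map h₀ h₀ ξ
        exact (congrArg (adj.algebra.IsMorphism adj.algebra) hε).mpr this
      obtain ⟨β, hβ, -⟩ := ha.existsUnique_cell hd h₀ qs ε hm
      refine ⟨β, ha.map_injective h₀ h₀ ?_⟩
      exact (map_cocone β).trans ((congrArg (mul γ) hβ).trans hε)

/-! ### Invertibility of the comparison tight-cell -/

/-- A criterion for the extension of the right adjoint along `c` exhibited by a tight-cell `e` with
`c ≫ e = r` to be `j`-absolute. -/
theorem isLeftOpcartesian_of_untranspose {c : D ⟶ C} {e : C ⟶ E} (hc : c ≫ e = r) {m : A ⟶ C}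
    (hm : adj.left ≫ c = m) {ω : HomCell m (.single (hom j e)) (𝟙 C)}
    (hme : m ≫ e = adj.left ≫ r)
    (h₁ : mul adj.unit (map ω e hme (Category.id_comp e)) = homCell j e)
    (h₂ : compCell (.single (lift (homCell j r) (Category.id_comp j) hc)) ω (Category.id_comp m)
      (Category.comp_id c) = map adj.untranspose c hm (Category.id_comp c)) :
    IsLeftOpcartesian (absoluteCell j (map (homCell c (𝟙 C)) e hc (Category.id_comp e))) := by
  subst hm
  have hA : 𝟙 A ≫ 𝟙 A = 𝟙 A := Category.comp_id _
  have hC : 𝟙 C ≫ 𝟙 C = 𝟙 C := Category.comp_id _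
  have hj := Category.id_comp j
  have he := Category.id_comp e
  have hl := Category.id_comp adj.left
  -- The splitting is ω, read as a 2-cell into C(c, 1) with the left adjoint on its side.
  refine adj.isLeftOpcartesian_of_section (lift ω rfl hC) ?_ ?_
  · refine (comp_lift _ hj he _ hA hC hj he).trans (lift_unique _ _ ?_)
    refine (single_id_comp _ hj he).trans ?_
    refine Eq.trans ?_ (comp_mul (.single adj.unitLift) (.single (lift ω rfl hC)) (homCell j r)
      (map (homCell c (𝟙 C)) e hc he) hj he rfl).symm
    refine h₁.symm.trans (congrArg₂ mul (lift_comp adj.unit hj rfl).symm ?_)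
    refine Eq.symm ((comp_map (.single (lift ω rfl hC)) (homCell c (𝟙 C)) e hc he rfl he rfl
      hC).trans ?_)
    exact congrArg (fun z => map z e hme he) (lift_comp ω rfl hC)
  · refine (comp_lift ω rfl hC (.single (absoluteCell j _)) hl hC (Category.id_comp _) hC).trans ?_
    refine congrArg (fun z => lift z rfl hC) ?_
    refine (comp_lift_mul_map ω (homCell j r) (homCell c (𝟙 C)) hc he (Category.comp_id c) hC).trans
      ?_
    exact congrArg₂ mul h₂ (map_id _ _ _)

theorem isLeftOpcartesian_along_id (adj : RelativeAdjunction j r) :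
    IsLeftOpcartesian (absoluteCell j
    (map (homCell (𝟙 D) (𝟙 D)) r (Category.id_comp r) (Category.id_comp r))) := by
  refine adj.isLeftOpcartesian_of_untranspose (Category.id_comp r) (Category.comp_id adj.left)
    (ω := adj.untranspose) rfl adj.unit_act ?_
  rw [lift_homCell]
  exact (single_id_comp _ _ _).trans (map_id _ _ _).symm

/-- The operator of an algebra is a graded morphism from the free algebra, its graded morphism law
being the associativity law. Lifting it through the algebra object gives ω; the unit law gives the
first condition of the criterion, and the second is checked after postcomposing the carrier. -/
theorem isLeftOpcartesian_along_comparison {a : adj.monad.Algebra C} (ha : a.IsAlgebraObject)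
    {i : D ⟶ C} (hi : a.Factors adj.algebra i) : IsLeftOpcartesian (absoluteCell j
      (map (homCell i (𝟙 C)) a.carrier hi.comp_carrier (Category.id_comp a.carrier))) := by
  have hC := Category.id_comp a.carrier
  have hfree : adj.algebra.Factors adj.monad.freeAlgebra adj.left := ⟨rfl, rfl⟩
  have hf : a.Factors adj.monad.freeAlgebra (adj.left ≫ i) := hi.comp hfree
  obtain ⟨ω, hω, -⟩ := ha.existsUnique_cell hf (.refl a) (.single (hom j a.carrier)) a.act a.ext_act
  refine adj.isLeftOpcartesian_of_untranspose hi.comp_carrier rfl (ω := ω) hf.comp_carrier ?_ ?_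
  · exact (congrArg (mul adj.unit) hω).trans a.unit_act
  · refine ha.map_injective hf hi ?_
    refine (comp_map (.single (lift (homCell j r) (Category.id_comp j) hi.comp_carrier)) ω a.carrier
      hf.comp_carrier hC (Category.id_comp _) hi.comp_carrier _ _).symm.trans ?_
    refine (congrArg (fun z => compCell (.single (lift (homCell j r) (Category.id_comp j)
      hi.comp_carrier)) z (Category.id_comp _) hi.comp_carrier) hω).trans ?_
    refine hi.extend_act.trans ?_
    exact (map_map adj.untranspose i a.carrier hi.comp_carrier rfl (Category.id_comp i) _ _).symm

theorem isIso_comparison (hj : IsDense j) (hr : StrictlyCreatesAbsoluteExtensions j r)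
    {a : adj.monad.Algebra C} (ha : a.IsAlgebraObject) {i : D ⟶ C}
    (hi : a.Factors adj.algebra i) : IsIso i := by
  have hu := Category.id_comp a.carrier
  have hr' := Category.id_comp r
  have hD : 𝟙 D ≫ 𝟙 D = 𝟙 D := Category.comp_id _
  let γ : HomCell r (.single (hom i (𝟙 C))) a.carrier :=
    map (homCell i (𝟙 C)) a.carrier hi.comp_carrier hu
  have hγ : IsLeftOpcartesian (absoluteCell j γ) := adj.isLeftOpcartesian_along_comparison ha hi
  obtain ⟨⟨i', γ'⟩, ⟨hi', hγ'⟩, -, -⟩ :=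
    hr i a.carrier γ (hj.isColimit hγ) (isAbsolute_of_isLeftOpcartesian hγ)
  dsimp only at hi' hγ'
  have hi'i : (i' ≫ i) ≫ a.carrier = a.carrier := by
    rw [Category.assoc, hi.comp_carrier]
    exact hi'
  -- Both tight-cells restrict the algebra a to itself. For i' ≫ i, the operators are compared after
  -- the canonical 2-cell, where by `key` any 2-cell lying over γ determines the result.
  have e₁ : i' ≫ i = 𝟙 C := by
    refine (ha.existsUnique_tight a).unique ⟨hi'i, ?_⟩ (.refl a)
    have key : ∀ {d : C ⟶ C} (hd : d ≫ a.carrier = a.carrier) (ε : HomCell i (.single _) d),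
        map ε a.carrier hi.comp_carrier hd = γ →
        compCell (.single (absoluteCell j γ)) (extend a.act (homCell j a.carrier) d hd)
          (Category.id_comp _) hu = mul (extend a.act (homCell j r) i hi.comp_carrier) γ := by
      intro d hd ε hε
      refine (comp_extend a.act (homCell j a.carrier) d hd (.single (absoluteCell j γ)) hu
        (Category.id_comp d)).trans ?_
      refine (congrArg (fun z => extend a.act z d hd)
        (absoluteCell_comp j γ (Category.id_comp j) hu)).trans ?_
      rw [← hε]
      exact extend_mul_map a.act (homCell j r) ε hi.comp_carrier hd
    refine ((hγ (.nil C) (adj.left ≫ r) (VirtualEquipment.unit E) a.carrier _).unique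
      (key hi'i (map γ' i (Category.id_comp i) rfl) ?_) (key hu (homCell i (𝟙 C)) rfl)).trans
        (extend_homCell _ _)
    exact (map_map γ' i a.carrier hi.comp_carrier _ _ _ _).trans hγ'
  have hii' : (i ≫ i') ≫ r = r := by
    rw [Category.assoc, hi']
    exact hi.comp_carrier
  -- Creation is now applied to r as its own extension along the identity. Both 𝟙 D and i ≫ i' carry
  -- a lift of that cocone.
  have e₂ : i ≫ i' = 𝟙 D := by
    have hδ := adj.isLeftOpcartesian_along_id
    obtain ⟨x, -, hx, -⟩ :=
      hr (𝟙 D) r _ (hj.isColimit hδ) (isAbsolute_of_isLeftOpcartesian hδ)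
    have hi₁ := Category.id_comp i
    have hi₂ := Category.comp_id i
    -- Evaluating γ' at the identity of i gives a 2-cell 1 ⇒ i ≫ i' lying over the identity of r,
    -- because γ' lies over γ.
    let η : HomCell (𝟙 D) (.nil D) (i ≫ i') :=
      compCell (.single (lift (idHom i) hi₁ hi₂)) γ' hD rfl
    have hη : map η r hr' hii' = idHom r := by
      refine (comp_map (.single (lift (idHom i) hi₁ hi₂)) γ' r hr' hi' hr' hi.comp_carrier hD
        rfl).symm.trans ?_
      refine (congrArg (fun z => compCell (.single (lift (idHom i) hi₁ hi₂)) z hr'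
        hi.comp_carrier) hγ').trans ?_
      refine (comp_map (.single (lift (idHom i) hi₁ hi₂)) (homCell i (𝟙 C)) a.carrier
        hi.comp_carrier hu hr' hi.comp_carrier hi₁ hi₂).trans ?_
      refine (congrArg (fun z => map z a.carrier hi.comp_carrier hi.comp_carrier)
        (lift_comp (idHom i) hi₁ hi₂)).trans ?_
      exact idHom_map i a.carrier _ _
    have hy₁ := hx ⟨i ≫ i', mul η (map (homCell (𝟙 D) (𝟙 D)) (i ≫ i') (Category.id_comp _)
      (Category.id_comp _))⟩ ⟨hii', by
        refine (map_mul η _ r hr' hii' hii').trans ?_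
        refine (congrArg₂ mul hη (map_map (homCell (𝟙 D) (𝟙 D)) (i ≫ i') r hii' _ _ _ _)).trans ?_
        exact idHom_mul _⟩
    have hy₂ := hx ⟨𝟙 D, homCell (𝟙 D) (𝟙 D)⟩ ⟨hr', rfl⟩
    exact congrArg Sigma.fst (hy₁.trans hy₂.symm)
  exact ⟨i', e₂, e₁⟩

end RelativeAdjunction

end
end Equip

theorem mainTheorem1 {X : Type u} [Equip.VirtualEquipment.{t, w, v, u} X] {A D E : X}
    (j : A ⟶ E) (hj : Equip.IsDense j) (r : D ⟶ E) :
    Equip.IsStrictlyMonadic j r ↔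
      (∃ adj : Equip.RelativeAdjunction j r, adj.monad.HasAlgebraObject) ∧
        Equip.StrictlyCreatesAbsoluteExtensions j r := by
  constructor
  · rintro ⟨adj, M, a, ha, hiso⟩
    -- Being an algebra object transports along the invertible comparison, so r with its induced
    -- algebra structure is one.
    exact ⟨⟨adj, M, a, ha⟩, adj.strictlyCreates_of_isAlgebraObject
      (ha.of_isIso (i := ha.comparison adj.algebra)
        (ha.existsUnique_tight adj.algebra).choose_spec.1)⟩
  · rintro ⟨⟨adj, M, a, ha⟩, hr⟩
    exact ⟨adj, M, a, ha,
      adj.isIso_comparison hj hr ha (ha.existsUnique_tight adj.algebra).choose_spec.1⟩
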